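/- **Data.** Let $\Lambda_\circ,\Lambda_\bullet,\Gamma$ be even, positive definite lattices of the same finite rank and let $\pi_\circ\colon\Gamma\to\Lambda_\circ$, $\pi_\bullet\colon\Gamma\to\Lambda_\bullet$ be lattice morphisms (form preserving, hence injective). Put $\mathfrak h=\Gamma\otimes\mathbb R$, $H=\mathfrak h/\Gamma$, $T_\circ=(\Lambda_\circ\otimes\mathbb R)/\Lambda_\circ$, $T_\bullet=(\Lambda_\bullet\otimes\mathbb R)/\Lambda_\bullet$. The real extensions of $\pi_\circ,\pi_\bullet$ are isometric isomorphisms, through which $\Lambda_\circ$ and $\Lambda_\bullet$ are regarded as lattices in $\mathfrak h$; $\Lambda_\circ\cap\Lambda_\bullet$ and $\Lambda_\circ-\Lambda_\bullet=\{\lambda_\circ-\lambda_\bullet\}$ are formed in $\mathfrak h$. They contain $\Gamma$. **The bicoloured loop group.** Identify the circle with $\mathbb R/\mathbb Z$ and mark the points $q=0=1$ and $p=\tfrac12$. $L(T_\circ,H,T_\bullet)$ is the group of triples of smooth maps $\gamma_\circ\colon[\tfrac12,1]\to T_\circ$, $\gamma_{\rm m}\colon\{p,q\}\to H$, $\gamma_\bullet\colon[0,\tfrac12]\to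 T_\bullet$ such that $\gamma_\circ$ and $\gamma_\bullet$ take at $p$ and $q$ the values that are induced by $\gamma_{\rm m}$ via $\pi_\circ$ and $\pi_\bullet$, and such that for all $k\ge1$ the $k$-th derivatives of $\gamma_\circ$ and $\gamma_\bullet$, as vectors in $\mathfrak h$, agree at $p$ and agree at $q$. For such a $\gamma$, lift $\gamma_\circ$ and $\gamma_\bullet$ to smooth paths in $H$ with the value $\gamma_{\rm m}(p)$ at $p$ and glue them to a smooth path $\mathrm{Pth}(\gamma)\colon[0,1]\to H$. Let $\xi\colon[0,1]\to\mathfrak h$ be a lift of this path (unique up to adding an element of $\Gamma$), and put $\Delta'_\gamma=\xi(1)-\xi(0)\in\Lambda_\circ-\Lambda_\bullet$. **The central extension.** Let $\varepsilon$ be a normalised $\mathbb T$-valued $2$-cocycle on the group $\Lambda_\circ-\Lambda_\bullet$ with commutator map $\varepsilon(\lambda,\mu)\varepsilon(\mu,\lambda)^{-1}=e^{2\pi i(\frac12\langle\mu,\lambda\rangle+\langle\mu,\lambda_\bullet\rangle)}$ for $\lambda=\lambda_\circ-\lambda_\bullet$. Then $\widetilde L(T_\circ,H,T_\bullet)=L(T_\circ,H,T_\bullet)\times\mathbb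 T$ with the product $(\gamma,z)(\rho,w)=(\gamma+\rho,\,zw\,c(\gamma,\rho))$, where, for lifts $\xi$ of $\mathrm{Pth}(\gamma)$ and $\eta$ of $\mathrm{Pth}(\rho)$, $$c(\gamma,\rho)=\varepsilon(\Delta'_\gamma,\Delta'_\rho)\,e^{2\pi iS'(\xi,\eta)},\qquad S'(\xi,\eta)=\tfrac12\int_0^1\langle\xi'(t),\eta(t)\rangle\,dt+\tfrac12\langle\Delta'_\gamma,\eta(0)\rangle .$$ **The representations.** Let $V\mathfrak h$ be the space of smooth loops $\mathbb R/\mathbb Z\to\mathfrak h$ with $\int_0^1\xi=0$, put $S(\xi,\eta)=\frac12\int_0^1\langle\xi',\eta\rangle$, let $J$ be the complex structure $\sum_k(a_k\cos2\pi kt+b_k\sin2\pi kt)\mapsto\sum_k(a_k\sin2\pi kt-b_k\cos2\pi kt)$ on $V\mathfrak h$, and let $\langle\xi,\eta\rangle_J=2\pi\bigl(-S(\xi,J\eta)+i\,S(\xi,\eta)\bigr)$, a positive definite Hermitian form, linear in $\xi$. Let $\mathcal S$ be the symmetric Fock space of $(V\mathfrak h,\langle\cdot,\cdot\rangle_J)$;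 it has a total set of coherent vectors $e^\kappa=\sum_n\kappa^n/n!$, $\kappa\in V\mathfrak h$, with $\langle e^\kappa,e^\mu\rangle=e^{\langle\kappa,\mu\rangle_J}$. For $\xi\in V\mathfrak h$ and $z\in\mathbb T$ let $W(\xi,z)$ be the unitary operator on $\mathcal S$ with $W(\xi,z)e^\kappa=z\,e^{-\frac12\langle\xi,\xi\rangle_J-\langle\kappa,\xi\rangle_J}e^{\kappa+\xi}$. For a character $\chi$ of the finite group $(\Lambda_\circ\cap\Lambda_\bullet)/\Gamma$ and a continuous character $l$ of the torus $H$, let $W_{\chi,l}$ be the unitary representation on $\mathcal S$ of the subgroup $\{(\gamma,z):\Delta'_\gamma=0\}$ of $\widetilde L(T_\circ,H,T_\bullet)$ given by $$W_{\chi,l}(\gamma,z)=\chi\bigl(\gamma_{\rm m}(q)-\mathrm{Pth}(\gamma)(1)\bigr)\;l\bigl([\textstyle\int_0^1\xi]\bigr)\;W\bigl(\xi-\textstyle\int_0^1\xi,\,z\bigr),$$ where $\xi$ is a lift of $\mathrm{Pth}(\gamma)$ and $[x]\in H$ denotes the class of $x\in\mathfrak h$. Let $\operatorname{Ind}W_{\chi,l}$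 be the induced unitary representation of $\widetilde L(T_\circ,H,T_\bullet)$, on the Hilbert space direct sum of the fibres over the cosets of this subgroup. **Theorem.** Let $\chi,\chi'$ be characters of $(\Lambda_\circ\cap\Lambda_\bullet)/\Gamma$ and let $l,l'$ be continuous characters of $H$. The following are equivalent: 1. $\operatorname{Ind}W_{\chi,l}$ and $\operatorname{Ind}W_{\chi',l'}$ are unitarily isomorphic, i.e. there is a unitary intertwining operator between them; 2. $\operatorname{Ind}W_{\chi,l}$ and $\operatorname{Ind}W_{\chi',l'}$ are isomorphic, i.e. there is a bounded intertwining operator with bounded inverse between them; 3. $\chi'=\chi$, and $l'=l-\lambda$ for some $\lambda\in\Lambda_\circ-\Lambda_\bullet$; here $\lambda$ is regarded as the character $[x]\mapsto e^{2\pi i\langle\lambda,x\rangle}$ of $H$, i.e. $l'([x])=l([x])\,e^{-2\pi i\langle\lambda,x\rangle}$ for all $x\in\mathfrak h$. -/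

import Mathlib

open Set Filter Topology MeasureTheory
open scoped ContDiff RealInnerProductSpace ComplexConjugate ComplexOrder

set_option linter.unusedSectionVars false

noncomputable section

namespace TorusLoop

/-! ### Smooth mean-zero loops and their Heisenberg group data -/

variable {E : Type*} [NormedAddCommGroup E] [InnerProductSpace ℝ E] [FiniteDimensional ℝ E]

/-- The space `V𝔥` of smooth loops `S¹ = ℝ/ℤ → E` of mean zero, as `1`-periodic functions. -/
def MeanZeroLoops (E : Type*) [NormedAddCommGroup E] [InnerProductSpace ℝ E] :
    Submodule ℝ (ℝ → E) where
  carrier := {ξ | ContDiff ℝ ∞ ξ ∧ (∀ t, ξ (t + 1) = ξ t) ∧ ∫ t in (0 : ℝ)..1, ξ t = 0}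
  zero_mem' := ⟨contDiff_const, fun _ => rfl, by simp⟩
  add_mem' := by
    rintro ξ η ⟨h1, h2, h3⟩ ⟨k1, k2, k3⟩
    refine ⟨h1.add k1, fun t => by simp [h2 t, k2 t], ?_⟩
    have := intervalIntegral.integral_add (μ := volume)
      (h1.continuous.intervalIntegrable 0 1) (k1.continuous.intervalIntegrable 0 1)
    simpa [h3, k3] using this
  smul_mem' := by
    rintro c ξ ⟨h1, h2, h3⟩
    refine ⟨h1.const_smul c, fun t => by simp [h2 t], ?_⟩
    simp [h3]

/-- Fourier coefficient `∫₀¹ cos(2πkt) ξ(t) dt`. -/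
def cosCoeff (ξ : ℝ → E) (k : ℕ) : E := ∫ t in (0 : ℝ)..1, Real.cos (2 * Real.pi * k * t) • ξ t

/-- Fourier coefficient `∫₀¹ sin(2πkt) ξ(t) dt`. -/
def sinCoeff (ξ : ℝ → E) (k : ℕ) : E := ∫ t in (0 : ℝ)..1, Real.sin (2 * Real.pi * k * t) • ξ t

/-- The complex structure `J` on mean-zero loops: for `ξ = ∑ₖ (aₖ cos 2πkt + bₖ sin 2πkt)` with
`aₖ = 2 * cosCoeff ξ k` and `bₖ = 2 * sinCoeff ξ k` it is
`J ξ = ∑ₖ (aₖ sin 2πkt - bₖ cos 2πkt)`, i.e. multiplication by `-i` (by `i`) on the Fourier modes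
`e^{2πikt}` with `k > 0` (with `k < 0`). -/
def conjLoop (ξ : ℝ → E) (t : ℝ) : E :=
  ∑' k : ℕ, (2 : ℝ) • (Real.sin (2 * Real.pi * k * t) • cosCoeff ξ k
    - Real.cos (2 * Real.pi * k * t) • sinCoeff ξ k)

/-- The form `S(ξ, η) = ½ ∫₀¹ ⟨ξ', η⟩`. -/
def loopForm (ξ η : ℝ → E) : ℝ := (1 / 2) * ∫ t in (0 : ℝ)..1, ⟪deriv ξ t, η t⟫

lemma cosCoeff_deriv {ξ : ℝ → E} (h : ContDiff ℝ ∞ ξ) (h1 : ξ 1 = ξ 0) (k : ℕ) :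
    cosCoeff (deriv ξ) k = (2 * Real.pi * k) • sinCoeff ξ k := by
  have hd : ∀ t, HasDerivAt ξ (deriv ξ t) t := fun t =>
    ((h.differentiable (by simp)) t).hasDerivAt
  have hu : ∀ t : ℝ, HasDerivAt (fun t => Real.cos (2 * Real.pi * k * t))
      (-Real.sin (2 * Real.pi * k * t) * (2 * Real.pi * k)) t := fun t => by
    simpa using ((hasDerivAt_id t).const_mul (2 * Real.pi * k)).cos
  have := intervalIntegral.integral_smul_deriv_eq_deriv_smul (a := 0) (b := 1)
    (fun t _ => hu t) (fun t _ => hd t)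
    (by apply Continuous.intervalIntegrable; fun_prop)
    ((h.continuous_deriv (by simp)).intervalIntegrable _ _)
  have e1 : Real.cos (2 * Real.pi * k) = 1 := by
    rw [mul_comm]; exact Real.cos_nat_mul_two_pi k
  unfold cosCoeff sinCoeff
  rw [this, ← intervalIntegral.integral_smul]
  have e2 : ∀ t : ℝ, (-Real.sin (2 * Real.pi * k * t) * (2 * Real.pi * k)) • ξ t
      = -((2 * Real.pi * k) • Real.sin (2 * Real.pi * k * t) • ξ t) := fun t => by
    rw [smul_smul, ← neg_smul]; congr 1; ring
  simp_rw [e2, intervalIntegral.integral_neg]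
  simp [e1, h1]

lemma sinCoeff_deriv {ξ : ℝ → E} (h : ContDiff ℝ ∞ ξ) (k : ℕ) :
    sinCoeff (deriv ξ) k = -((2 * Real.pi * k) • cosCoeff ξ k) := by
  have hd : ∀ t, HasDerivAt ξ (deriv ξ t) t := fun t =>
    ((h.differentiable (by simp)) t).hasDerivAt
  have hu : ∀ t : ℝ, HasDerivAt (fun t => Real.sin (2 * Real.pi * k * t))
      (Real.cos (2 * Real.pi * k * t) * (2 * Real.pi * k)) t := fun t => by
    simpa using ((hasDerivAt_id t).const_mul (2 * Real.pi * k)).sin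
  have := intervalIntegral.integral_smul_deriv_eq_deriv_smul (a := 0) (b := 1)
    (fun t _ => hu t) (fun t _ => hd t)
    (by apply Continuous.intervalIntegrable; fun_prop)
    ((h.continuous_deriv (by simp)).intervalIntegrable _ _)
  have e1 : Real.sin (2 * Real.pi * k) = 0 := by
    have := Real.sin_nat_mul_pi (2 * k); push_cast at this; rw [← this]; ring_nf
  unfold cosCoeff sinCoeff
  rw [this, ← intervalIntegral.integral_smul]
  simp [e1, smul_smul]
  congr 1; ext t; congr 1; ring

lemma deriv_mem {ξ : ℝ → E} (h : ξ ∈ MeanZeroLoops E) : deriv ξ ∈ MeanZeroLoops E := by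
  obtain ⟨h1, h2, h3⟩ := h
  refine ⟨?_, fun t => ?_, ?_⟩
  · exact ((contDiff_infty_iff_deriv).1 h1).2
  · rw [← deriv_comp_add_const]; congr 1; ext t; exact h2 t
  · rw [intervalIntegral.integral_deriv_eq_sub (fun t _ => (h1.differentiable (by simp)) t)
      ((h1.continuous_deriv (by simp)).intervalIntegrable _ _)]
    simpa [sub_eq_zero] using h2 0

lemma norm_coeff_le {ξ : ℝ → E} (h : Continuous ξ) (k : ℕ) :
    ‖cosCoeff ξ k‖ ≤ ∫ t in (0 : ℝ)..1, ‖ξ t‖ ∧ ‖sinCoeff ξ k‖ ≤ ∫ t in (0 : ℝ)..1, ‖ξ t‖ := by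
  constructor
  all_goals
    refine (intervalIntegral.norm_integral_le_integral_norm zero_le_one).trans ?_
    refine intervalIntegral.integral_mono_on zero_le_one
      (by apply Continuous.intervalIntegrable; fun_prop)
      (by apply Continuous.intervalIntegrable; fun_prop) fun t _ => ?_
    rw [norm_smul]
    refine mul_le_of_le_one_left (norm_nonneg _) ?_
  · exact Real.abs_cos_le_one _
  · exact Real.abs_sin_le_one _

lemma coeff_decay {ξ : ℝ → E} (h : ξ ∈ MeanZeroLoops E) :
    ∃ C, ∀ k : ℕ, (k : ℝ) ^ 2 * ‖cosCoeff ξ k‖ ≤ C ∧ (k : ℝ) ^ 2 * ‖sinCoeff ξ k‖ ≤ C := by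
  have h' := deriv_mem h
  have h'' := deriv_mem h'
  refine ⟨∫ t in (0 : ℝ)..1, ‖deriv (deriv ξ) t‖, fun k => ?_⟩
  have p0 : ∀ {η : ℝ → E}, η ∈ MeanZeroLoops E → η 1 = η 0 := fun hη => by
    simpa using hη.2.1 0
  obtain ⟨a, b⟩ := norm_coeff_le h''.1.continuous k
  rw [cosCoeff_deriv h'.1 (p0 h'), sinCoeff_deriv h.1, norm_smul, norm_neg, norm_smul] at a
  rw [sinCoeff_deriv h'.1, cosCoeff_deriv h.1 (p0 h), norm_neg, norm_smul, norm_smul] at b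
  have hk : (k : ℝ) ≤ ‖2 * Real.pi * (k : ℝ)‖ := by
    rw [Real.norm_of_nonneg (by positivity)]
    have := Real.pi_gt_three
    nlinarith [(Nat.cast_nonneg k : (0 : ℝ) ≤ k)]
  rw [← mul_assoc] at a b
  have : (k : ℝ) ^ 2 ≤ ‖2 * Real.pi * (k : ℝ)‖ * ‖2 * Real.pi * (k : ℝ)‖ := by
    rw [sq]; gcongr
  exact ⟨(mul_le_mul_of_nonneg_right this (norm_nonneg _)).trans a,
    (mul_le_mul_of_nonneg_right this (norm_nonneg _)).trans b⟩

lemma coeff_zero {ξ : ℝ → E} (h : ξ ∈ MeanZeroLoops E) :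
    cosCoeff ξ 0 = 0 ∧ sinCoeff ξ 0 = 0 := by
  simpa [cosCoeff, sinCoeff] using h.2.2

lemma summable_coeff {ξ : ℝ → E} (h : ξ ∈ MeanZeroLoops E) :
    Summable (fun k => ‖cosCoeff ξ k‖) ∧ Summable (fun k => ‖sinCoeff ξ k‖) := by
  obtain ⟨C, hC⟩ := coeff_decay h
  have hs : Summable fun k : ℕ => C * (1 / (k : ℝ) ^ 2) :=
    (Real.summable_one_div_nat_pow.2 one_lt_two).mul_left C
  constructor
  all_goals
    refine Summable.of_nonneg_of_le (fun _ => norm_nonneg _) (fun k => ?_) hs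
    rcases Nat.eq_zero_or_pos k with rfl | hk
    · simp [coeff_zero h]
    have : (0 : ℝ) < (k : ℝ) ^ 2 := by positivity
    rw [mul_one_div, le_div_iff₀ this, mul_comm]
  · exact (hC k).1
  · exact (hC k).2

/-- Termwise integration against a trigonometric series. -/
lemma hasSum_integral_inner {F : ℝ → E} (hF : Continuous F) {p q : ℕ → E}
    (hp : Summable fun k => ‖p k‖) (hq : Summable fun k => ‖q k‖) :
    HasSum (fun k => ⟪cosCoeff F k, p k⟫ + ⟪sinCoeff F k, q k⟫)
      (∫ t in (0 : ℝ)..1, ⟪F t, ∑' k : ℕ, (Real.cos (2 * Real.pi * k * t) • p k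
        + Real.sin (2 * Real.pi * k * t) • q k)⟫) := by
  have hsum : ∀ t : ℝ, Summable fun k : ℕ => (Real.cos (2 * Real.pi * k * t) • p k
        + Real.sin (2 * Real.pi * k * t) • q k) := fun t => by
    refine Summable.of_norm_bounded (hp.add hq) fun k => ?_
    refine (norm_add_le _ _).trans ?_
    rw [norm_smul, norm_smul]
    exact add_le_add (mul_le_of_le_one_left (norm_nonneg _) (Real.abs_cos_le_one _))
      (mul_le_of_le_one_left (norm_nonneg _) (Real.abs_sin_le_one _))
  have key := intervalIntegral.hasSum_integral_of_dominated_convergence (a := 0) (b := 1)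
    (μ := volume)
    (F := fun (k : ℕ) (t : ℝ) => ⟪F t, Real.cos (2 * Real.pi * k * t) • p k
        + Real.sin (2 * Real.pi * k * t) • q k⟫)
    (f := fun t => ⟪F t, ∑' k : ℕ, (Real.cos (2 * Real.pi * k * t) • p k
        + Real.sin (2 * Real.pi * k * t) • q k)⟫)
    (fun k t => ‖F t‖ * (‖p k‖ + ‖q k‖))
    (fun k => by apply Continuous.aestronglyMeasurable; fun_prop)
    (fun k => by
      refine Filter.Eventually.of_forall fun t _ => (norm_inner_le_norm _ _).trans ?_
      refine mul_le_mul_of_nonneg_left ((norm_add_le _ _).trans ?_) (norm_nonneg _)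
      rw [norm_smul, norm_smul]
      exact add_le_add (mul_le_of_le_one_left (norm_nonneg _) (Real.abs_cos_le_one _))
        (mul_le_of_le_one_left (norm_nonneg _) (Real.abs_sin_le_one _)))
    (Filter.Eventually.of_forall fun t _ => (hp.add hq).mul_left _)
    (by
      simp_rw [tsum_mul_left]
      apply Continuous.intervalIntegrable; fun_prop)
    (Filter.Eventually.of_forall fun t _ => (hsum t).hasSum.mapL (innerSL ℝ (F t)))
  have : ∀ (f : ℝ → ℝ) (v : E), Continuous f →
      ⟪∫ t in (0 : ℝ)..1, f t • F t, v⟫ = ∫ t in (0 : ℝ)..1, ⟪F t, f t • v⟫ := by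
    intro f v hf
    rw [real_inner_comm]
    have := (innerSL ℝ v).intervalIntegral_comp_comm (μ := volume) (a := 0) (b := 1)
      (f := fun t => f t • F t) ((hf.smul hF).intervalIntegrable _ _)
    simp only [innerSL_apply_apply] at this
    rw [← this]
    congr 1; ext t
    rw [real_inner_smul_right, real_inner_smul_right, real_inner_comm]
  refine key.congr_fun ?_
  intro k
  unfold cosCoeff sinCoeff
  rw [this _ _ (by fun_prop), this _ _ (by fun_prop), ← intervalIntegral.integral_add
    (by apply Continuous.intervalIntegrable; fun_prop)
    (by apply Continuous.intervalIntegrable; fun_prop)]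
  simp_rw [inner_add_right]

lemma hasSum_fourier_scalar {f : ℝ → ℝ} (h : f ∈ MeanZeroLoops ℝ) (t : ℝ) :
    HasSum (fun k : ℕ => Real.cos (2 * Real.pi * k * t) * (2 * cosCoeff f k)
      + Real.sin (2 * Real.pi * k * t) * (2 * sinCoeff f k)) (f t) := by
  have : Fact ((0 : ℝ) < 1) := ⟨one_pos⟩
  have hper : Function.Periodic (fun t => (f t : ℂ)) 1 := fun t => by simp [h.2.1 t]
  have hc : Continuous fun t => (f t : ℂ) := Complex.continuous_ofReal.comp h.1.continuous
  let g : C(AddCircle (1 : ℝ), ℂ) := ⟨hper.lift, by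
    exact continuous_quot_lift _ hc⟩
  have hcf : ∀ n : ℤ, fourierCoeff g n
      = ∫ x in (0 : ℝ)..1, Complex.exp (-(2 * Real.pi * Complex.I * n * x)) * f x := by
    intro n
    rw [fourierCoeff_eq_intervalIntegral _ n 0]
    simp only [zero_add, div_one, one_smul]
    congr 1; ext x
    rw [fourier_coe_apply]
    change _ • ((hper.lift (x : AddCircle (1 : ℝ)))) = _
    rw [Function.Periodic.lift_coe, smul_eq_mul]
    congr 2
    push_cast; ring
  have hre : ∀ k : ℕ, ((cosCoeff f k : ℝ) : ℂ) = ∫ x in (0 : ℝ)..1,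
      ((Real.cos (2 * Real.pi * k * x) * f x : ℝ) : ℂ) := fun k => by
    rw [intervalIntegral.integral_ofReal]; rfl
  have him : ∀ k : ℕ, ((sinCoeff f k : ℝ) : ℂ) = ∫ x in (0 : ℝ)..1,
      ((Real.sin (2 * Real.pi * k * x) * f x : ℝ) : ℂ) := fun k => by
    rw [intervalIntegral.integral_ofReal]; rfl
  have hfc := h.1.continuous
  have hpos : ∀ k : ℕ, fourierCoeff g k = cosCoeff f k - Complex.I * sinCoeff f k := by
    intro k
    rw [hcf, hre, him, ← intervalIntegral.integral_const_mul, ← intervalIntegral.integral_sub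
      (by apply Continuous.intervalIntegrable; fun_prop)
      (by apply Continuous.intervalIntegrable; fun_prop)]
    congr 1; ext x
    have : -(2 * Real.pi * Complex.I * ((k : ℤ) : ℂ) * x)
        = ((-(2 * Real.pi * k * x) : ℝ) : ℂ) * Complex.I := by push_cast; ring
    rw [this, Complex.exp_mul_I, ← Complex.ofReal_cos, ← Complex.ofReal_sin, Real.cos_neg,
      Real.sin_neg]
    push_cast; ring
  have hneg : ∀ k : ℕ, fourierCoeff g (-k) = cosCoeff f k + Complex.I * sinCoeff f k := by
    intro k
    rw [hcf, hre, him, ← intervalIntegral.integral_const_mul, ← intervalIntegral.integral_add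
      (by apply Continuous.intervalIntegrable; fun_prop)
      (by apply Continuous.intervalIntegrable; fun_prop)]
    congr 1; ext x
    have : -(2 * Real.pi * Complex.I * ((-(k : ℤ) : ℤ) : ℂ) * x)
        = ((2 * Real.pi * k * x : ℝ) : ℂ) * Complex.I := by push_cast; ring
    rw [this, Complex.exp_mul_I, ← Complex.ofReal_cos, ← Complex.ofReal_sin]
    push_cast; ring
  have hsum : Summable (fourierCoeff g) := by
    obtain ⟨s1, s2⟩ := summable_coeff h
    have hb : ∀ z : ℂ, ∀ k : ℕ, (z = cosCoeff f k - Complex.I * sinCoeff f k ∨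
        z = cosCoeff f k + Complex.I * sinCoeff f k) → ‖z‖ ≤ ‖cosCoeff f k‖ + ‖sinCoeff f k‖ := by
      rintro z k (rfl | rfl)
      · refine (norm_sub_le _ _).trans ?_
        simp
      · refine (norm_add_le _ _).trans ?_
        simp
    refine Summable.of_nat_of_neg ?_ ?_
    · exact Summable.of_norm_bounded (s1.add s2) fun k => hb _ _ (Or.inl (hpos k))
    · exact Summable.of_norm_bounded (s1.add s2) fun k => hb _ _ (Or.inr (hneg k))
  have key := (has_pointwise_sum_fourier_series_of_summable hsum (t : AddCircle (1 : ℝ))).nat_add_neg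
  have h0 : fourierCoeff g 0 = 0 := by
    have := hpos 0
    obtain ⟨a, b⟩ := coeff_zero h
    simpa [a, b] using this
  rw [h0, zero_smul, add_zero] at key
  have hg : g (t : AddCircle (1 : ℝ)) = (f t : ℂ) := hper.lift_coe t
  rw [hg] at key
  have : ∀ k : ℕ, fourierCoeff g k • fourier (k : ℤ) (t : AddCircle (1 : ℝ))
      + fourierCoeff g (-k) • fourier (-(k : ℤ)) (t : AddCircle (1 : ℝ))
      = ((Real.cos (2 * Real.pi * k * t) * (2 * cosCoeff f k)
      + Real.sin (2 * Real.pi * k * t) * (2 * sinCoeff f k) : ℝ) : ℂ) := by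
    intro k
    rw [hpos, hneg, fourier_coe_apply, fourier_coe_apply]
    have e1 : (2 * Real.pi * Complex.I * ((k : ℤ) : ℂ) * t / (1 : ℝ) : ℂ)
      = ((2 * Real.pi * k * t : ℝ) : ℂ) * Complex.I := by push_cast; ring
    have e2 : (2 * Real.pi * Complex.I * ((-(k : ℤ) : ℤ) : ℂ) * t / (1 : ℝ) : ℂ)
      = ((-(2 * Real.pi * k * t) : ℝ) : ℂ) * Complex.I := by push_cast; ring
    rw [e1, e2, Complex.exp_mul_I, Complex.exp_mul_I, ← Complex.ofReal_cos, ← Complex.ofReal_sin,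
      ← Complex.ofReal_cos, ← Complex.ofReal_sin, Real.cos_neg, Real.sin_neg]
    simp only [smul_eq_mul]
    push_cast
    ring_nf
    rw [Complex.I_sq]; ring
  simp_rw [this] at key
  exact_mod_cast key

lemma tsum_fourier {ξ : ℝ → E} (h : ξ ∈ MeanZeroLoops E) (t : ℝ) :
    ∑' k : ℕ, (Real.cos (2 * Real.pi * k * t) • (2 : ℝ) • cosCoeff ξ k
      + Real.sin (2 * Real.pi * k * t) • (2 : ℝ) • sinCoeff ξ k) = ξ t := by
  have := FiniteDimensional.complete ℝ E
  obtain ⟨s1, s2⟩ := summable_coeff h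
  have hsum : Summable fun k : ℕ => (Real.cos (2 * Real.pi * k * t) • (2 : ℝ) • cosCoeff ξ k
        + Real.sin (2 * Real.pi * k * t) • (2 : ℝ) • sinCoeff ξ k) := by
    refine Summable.of_norm_bounded ((s1.mul_left 2).add (s2.mul_left 2)) fun k => ?_
    refine (norm_add_le _ _).trans ?_
    rw [norm_smul, norm_smul, norm_smul, norm_smul, Real.norm_two]
    exact add_le_add (mul_le_of_le_one_left (by positivity) (Real.abs_cos_le_one _))
      (mul_le_of_le_one_left (by positivity) (Real.abs_sin_le_one _))
  refine ext_inner_left ℝ fun e => ?_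
  have h1 := hsum.hasSum.mapL (innerSL ℝ e)
  have hm : (fun t => ⟪e, ξ t⟫) ∈ MeanZeroLoops ℝ := by
    refine ⟨contDiff_const.inner ℝ h.1, fun t => by simp only [h.2.1 t], ?_⟩
    have := (innerSL ℝ e).intervalIntegral_comp_comm (μ := volume) (a := 0) (b := 1)
      (h.1.continuous.intervalIntegrable _ _)
    simpa [h.2.2] using this
  have h2 := hasSum_fourier_scalar hm t
  have hco : ∀ (f : ℝ → ℝ), Continuous f → ∫ t in (0 : ℝ)..1, f t • ⟪e, ξ t⟫
      = ⟪e, ∫ t in (0 : ℝ)..1, f t • ξ t⟫ := fun f hf => by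
    have := (innerSL ℝ e).intervalIntegral_comp_comm (μ := volume) (a := 0) (b := 1)
      (f := fun t => f t • ξ t) ((hf.smul h.1.continuous).intervalIntegrable _ _)
    simp only [innerSL_apply_apply, real_inner_smul_right] at this
    exact this
  refine h1.unique (h2.congr_fun fun k => ?_)
  unfold cosCoeff sinCoeff
  rw [hco _ (by fun_prop), hco _ (by fun_prop)]
  simp [inner_add_right, real_inner_smul_right]

/-- The Hermitian form `⟨ξ, η⟩_J = 2π (ω(ξ, Jη) - i ω(ξ, η))`, complex linear in the first variable
with respect to `J`, where `ω = -S` is the symplectic form of the Heisenberg group whose cocycle is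
`e^{-2πiω} = e^{2πiS}`. -/
def loopHermitian (ξ η : ℝ → E) : ℂ :=
  2 * Real.pi * (((-loopForm ξ (conjLoop η) : ℝ) : ℂ) - Complex.I * ((-loopForm ξ η : ℝ) : ℂ))

lemma hasSum_loopForm {ξ η : ℝ → E} (hξ : ξ ∈ MeanZeroLoops E) (hη : η ∈ MeanZeroLoops E) :
    HasSum (fun k : ℕ => 2 * Real.pi * k *
      (⟪sinCoeff ξ k, cosCoeff η k⟫ - ⟪cosCoeff ξ k, sinCoeff η k⟫)) (loopForm ξ η) ∧
    HasSum (fun k : ℕ => - (2 * Real.pi * k *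
      (⟪cosCoeff ξ k, cosCoeff η k⟫ + ⟪sinCoeff ξ k, sinCoeff η k⟫)))
      (loopForm ξ (conjLoop η)) := by
  obtain ⟨s1, s2⟩ := summable_coeff hη
  have p0 : ξ 1 = ξ 0 := by simpa using hξ.2.1 0
  constructor
  · have := (hasSum_integral_inner (deriv_mem hξ).1.continuous
      (p := fun k => (2 : ℝ) • cosCoeff η k) (q := fun k => (2 : ℝ) • sinCoeff η k)
      (by simpa [norm_smul] using s1.mul_left 2) (by simpa [norm_smul] using s2.mul_left 2)).mul_left
      (1 / 2)
    simp_rw [tsum_fourier hη] at this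
    refine this.congr_fun fun k => ?_
    rw [cosCoeff_deriv hξ.1 p0, sinCoeff_deriv hξ.1]
    simp only [inner_neg_left, real_inner_smul_left, real_inner_smul_right]
    ring
  · have := (hasSum_integral_inner (deriv_mem hξ).1.continuous
      (p := fun k => -((2 : ℝ) • sinCoeff η k)) (q := fun k => (2 : ℝ) • cosCoeff η k)
      (by simpa [norm_smul] using s2.mul_left 2) (by simpa [norm_smul] using s1.mul_left 2)).mul_left
      (1 / 2)
    have e : ∀ t, ∑' k : ℕ, (Real.cos (2 * Real.pi * k * t) • -((2 : ℝ) • sinCoeff η k)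
        + Real.sin (2 * Real.pi * k * t) • (2 : ℝ) • cosCoeff η k) = conjLoop η t := fun t => by
      unfold conjLoop
      congr 1; ext k
      rw [smul_neg, smul_sub, smul_comm (2 : ℝ), smul_comm (2 : ℝ)]
      abel
    simp_rw [e] at this
    refine this.congr_fun fun k => ?_
    rw [cosCoeff_deriv hξ.1 p0, sinCoeff_deriv hξ.1]
    simp only [inner_neg_left, inner_neg_right, real_inner_smul_left, real_inner_smul_right]
    ring

/-- Coordinates of the Fourier modes; they diagonalise `loopHermitian`. -/
def mode (ξ : ℝ → E) (k : ℕ) (i : Fin (Module.finrank ℝ E)) : ℂ :=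
  (⟪cosCoeff ξ k, stdOrthonormalBasis ℝ E i⟫ : ℂ)
    + Complex.I * (⟪sinCoeff ξ k, stdOrthonormalBasis ℝ E i⟫ : ℂ)

lemma hasSum_loopHermitian {ξ η : ℝ → E} (hξ : ξ ∈ MeanZeroLoops E) (hη : η ∈ MeanZeroLoops E) :
    HasSum (fun k : ℕ => 4 * (Real.pi : ℂ) ^ 2 * k * ∑ i, mode ξ k i * conj (mode η k i))
      (loopHermitian ξ η) := by
  obtain ⟨h1, h2⟩ := hasSum_loopForm hξ hη
  have h1' := h1.neg.mapL Complex.ofRealCLM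
  have h2' := h2.neg.mapL Complex.ofRealCLM
  have := (h2'.sub (h1'.mul_left Complex.I)).mul_left (2 * (Real.pi : ℂ))
  refine this.congr_fun fun k => ?_
  have e : ∀ x y : E, ⟪x, y⟫ = ∑ i, ⟪x, stdOrthonormalBasis ℝ E i⟫ *
      ⟪y, stdOrthonormalBasis ℝ E i⟫ := fun x y => by
    rw [← (stdOrthonormalBasis ℝ E).sum_inner_mul_inner x y]
    simp_rw [real_inner_comm y]
  simp only [Complex.ofRealCLM_apply]
  rw [e (cosCoeff ξ k), e (cosCoeff ξ k), e (sinCoeff ξ k), e (sinCoeff ξ k)]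
  push_cast
  have e3 : ∀ i, mode ξ k i * conj (mode η k i) =
     (⟪cosCoeff ξ k, stdOrthonormalBasis ℝ E i⟫ : ℂ) * ⟪cosCoeff η k, stdOrthonormalBasis ℝ E i⟫
     + (⟪sinCoeff ξ k, stdOrthonormalBasis ℝ E i⟫ : ℂ) * ⟪sinCoeff η k, stdOrthonormalBasis ℝ E i⟫
     + Complex.I * ((⟪sinCoeff ξ k, stdOrthonormalBasis ℝ E i⟫ : ℂ) *
        ⟪cosCoeff η k, stdOrthonormalBasis ℝ E i⟫)
     - Complex.I * ((⟪cosCoeff ξ k, stdOrthonormalBasis ℝ E i⟫ : ℂ) *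
        ⟪sinCoeff η k, stdOrthonormalBasis ℝ E i⟫) := fun i => by
    simp only [mode, map_add, map_mul, Complex.conj_ofReal, Complex.conj_I]
    linear_combination (-(⟪sinCoeff ξ k, stdOrthonormalBasis ℝ E i⟫ : ℂ) *
      ⟪sinCoeff η k, stdOrthonormalBasis ℝ E i⟫) * Complex.I_sq
  simp_rw [e3, Finset.sum_sub_distrib, Finset.sum_add_distrib, ← Finset.mul_sum]
  ring

lemma loopHermitian_conj {ξ η : ℝ → E} (hξ : ξ ∈ MeanZeroLoops E) (hη : η ∈ MeanZeroLoops E) :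
    conj (loopHermitian ξ η) = loopHermitian η ξ := by
  have h1 := (hasSum_loopHermitian hξ hη).mapL (Complex.conjCLE : ℂ →L[ℝ] ℂ)
  refine h1.unique ((hasSum_loopHermitian hη hξ).congr_fun fun k => ?_)
  have h4 : (starRingEnd ℂ) 4 = 4 := map_ofNat _ 4
  simp [mul_comm, h4]

lemma mode_add {ξ η : ℝ → E} (hξ : ξ ∈ MeanZeroLoops E) (hη : η ∈ MeanZeroLoops E) (k i) :
    mode (ξ + η) k i = mode ξ k i + mode η k i := by
  have hx := hξ.1.continuous
  have hy := hη.1.continuous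
  have h1 : cosCoeff (ξ + η) k = cosCoeff ξ k + cosCoeff η k := by
    unfold cosCoeff
    rw [← intervalIntegral.integral_add (by apply Continuous.intervalIntegrable; fun_prop)
      (by apply Continuous.intervalIntegrable; fun_prop)]
    simp [smul_add]
  have h2 : sinCoeff (ξ + η) k = sinCoeff ξ k + sinCoeff η k := by
    unfold sinCoeff
    rw [← intervalIntegral.integral_add (by apply Continuous.intervalIntegrable; fun_prop)
      (by apply Continuous.intervalIntegrable; fun_prop)]
    simp [smul_add]
  simp only [mode, h1, h2, inner_add_left]
  push_cast; ring

lemma loopHermitian_add_left {ξ η ζ : ℝ → E} (hξ : ξ ∈ MeanZeroLoops E)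
    (hη : η ∈ MeanZeroLoops E) (hζ : ζ ∈ MeanZeroLoops E) :
    loopHermitian (ξ + η) ζ = loopHermitian ξ ζ + loopHermitian η ζ := by
  refine (hasSum_loopHermitian (add_mem hξ hη) hζ).unique
    (((hasSum_loopHermitian hξ hζ).add (hasSum_loopHermitian hη hζ)).congr_fun fun k => ?_)
  simp_rw [mode_add hξ hη, add_mul, Finset.sum_add_distrib]
  ring

lemma loopHermitian_im (ξ η : ℝ → E) :
    (loopHermitian ξ η).im = 2 * Real.pi * loopForm ξ η := by
  simp [loopHermitian]

lemma posSemidef_loopHermitian :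
    Matrix.PosSemidef (Matrix.of fun ξ η : MeanZeroLoops E => loopHermitian (η : ℝ → E) ξ) := by
  refine ⟨?_, fun x => ?_⟩
  · ext ξ η
    exact loopHermitian_conj ξ.2 η.2
  · have hs : HasSum (fun k : ℕ => 4 * (Real.pi : ℂ) ^ 2 * k * ∑ i,
        (star (x.sum fun ξ c => mode (ξ : ℝ → E) k i * c) *
          (x.sum fun ξ c => mode (ξ : ℝ → E) k i * c)))
        (x.sum fun ξ c => x.sum fun η d => star c * loopHermitian (η : ℝ → E) ξ * d) := by
      have h0 : HasSum (fun k : ℕ => x.sum fun ξ c => x.sum fun η d => star c *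
          (4 * (Real.pi : ℂ) ^ 2 * k * ∑ i, mode (η : ℝ → E) k i * conj (mode (ξ : ℝ → E) k i)) * d)
          (x.sum fun ξ c => x.sum fun η d => star c * loopHermitian (η : ℝ → E) ξ * d) := by
        simp only [Finsupp.sum]
        exact hasSum_sum fun ξ _ => hasSum_sum fun η _ =>
          ((hasSum_loopHermitian η.2 ξ.2).mul_left _).mul_right _
      refine h0.congr_fun fun k => ?_
      simp only [Finsupp.sum, star_sum, Finset.sum_mul_sum, Finset.mul_sum, Finset.sum_mul]
      conv_rhs => rw [Finset.sum_comm]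
      rw [Finset.sum_comm]
      refine Finset.sum_congr rfl fun ξ _ => ?_
      rw [Finset.sum_comm]
      refine Finset.sum_congr rfl fun η _ => Finset.sum_congr rfl fun i _ => ?_
      simp only [star_mul', Complex.star_def]
      ring
    exact hs.nonneg fun k => mul_nonneg (by positivity)
      (Finset.sum_nonneg fun i _ => star_mul_self_nonneg _)

lemma posSemidef_exp {ι : Type*} {M : Matrix ι ι ℂ} (hM : M.PosSemidef) :
    Matrix.PosSemidef (Matrix.of fun i j => Complex.exp (M i j)) := by
  have hpow : ∀ n : ℕ, Matrix.PosSemidef (Matrix.of fun i j => M i j ^ n) := by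
    intro n
    induction n with
    | zero =>
      refine ⟨by ext; simp, fun x => ?_⟩
      simp only [Matrix.of_apply, pow_zero, mul_one]
      have : (x.sum fun i xi => x.sum fun j xj => star xi * xj)
        = star (x.sum fun _ xi => xi) * (x.sum fun _ xi => xi) := by
        simp [Finsupp.sum, Finset.sum_mul_sum]
      rw [this]
      exact star_mul_self_nonneg _
    | succ n ih =>
      have e : (Matrix.of fun i j => M i j ^ (n + 1))
          = Matrix.hadamard (Matrix.of fun i j => M i j ^ n) M := by
        ext i j
        simp [Matrix.hadamard, pow_succ]
      rw [e]
      exact ih.hadamard hM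
  refine ⟨?_, fun x => ?_⟩
  · ext i j
    have := hM.1.apply i j
    simp only [Matrix.conjTranspose_apply, Matrix.of_apply, ← this]
    simp [← Complex.exp_conj]
  · have hs : HasSum (fun n : ℕ => ((n.factorial : ℂ)⁻¹ *
        x.sum fun i xi => x.sum fun j xj => star xi * M i j ^ n * xj))
        (x.sum fun i xi => x.sum fun j xj => star xi * Complex.exp (M i j) * xj) := by
      simp only [Finsupp.sum, Finset.mul_sum]
      refine hasSum_sum fun i _ => hasSum_sum fun j _ => ?_
      have h0 : HasSum (fun n : ℕ => M i j ^ n / n.factorial) (Complex.exp (M i j)) := by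
        rw [Complex.exp_eq_exp_ℂ]; exact NormedSpace.expSeries_div_hasSum_exp _
      refine ((h0.mul_left (star (x i))).mul_right (x j)).congr_fun fun n => ?_
      ring
    exact hs.nonneg fun n => mul_nonneg (by positivity) ((hpow n).2 x)

/-! ### Fock space and the Weyl operators -/

/-- Finite formal combinations of the coherent vectors `e^ξ`, `ξ ∈ V𝔥`. -/
abbrev PreFock (E : Type*) [NormedAddCommGroup E] [InnerProductSpace ℝ E] : Type _ :=
  MeanZeroLoops E →₀ ℂ

/-- The inner product with `⟨e^ξ, e^η⟩ = e^{⟨ξ, η⟩_J}`. In Mathlib's convention `inner ℂ x y` is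
linear in `y`, so that `inner ℂ e^ξ e^η = e^{⟨η, ξ⟩_J}`. -/
@[reducible]
def preFockCore (E : Type*) [NormedAddCommGroup E] [InnerProductSpace ℝ E]
    [FiniteDimensional ℝ E] : PreInnerProductSpace.Core ℂ (PreFock E) where
  inner f g := f.sum fun ξ c => g.sum fun η d =>
    star c * Complex.exp (loopHermitian (η : ℝ → E) ξ) * d
  conj_inner_symm f g := by
    rw [Finsupp.sum_comm]
    simp only [map_finsuppSum]
    congr! 4
    funext η d
    rw [map_mul, map_mul, ← Complex.exp_conj, loopHermitian_conj (Subtype.coe_prop _)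
      (Subtype.coe_prop _)]
    simp only [Complex.star_def, Complex.conj_conj]
    ring
  re_inner_nonneg f := (Complex.nonneg_iff.1 ((posSemidef_exp posSemidef_loopHermitian).2 f)).1
  add_left f g k := by
    rw [Finsupp.sum_add_index'] <;> simp [← Finsupp.sum_add, add_mul]
  smul_left f g r := by
    rw [Finsupp.sum_smul_index] <;> simp [Finsupp.mul_sum, ← mul_assoc]

instance : SeminormedAddCommGroup (PreFock E) :=
  @InnerProductSpace.Core.toSeminormedAddCommGroup ℂ (PreFock E) _ _ _ (preFockCore E)

instance : InnerProductSpace ℂ (PreFock E) := .ofCore (preFockCore E)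

/-- The symmetric (bosonic) Fock space of `(V𝔥, ⟨·,·⟩_J)`, presented through its exponential vectors:
the Hilbert space completion of the span of the coherent vectors `e^ξ = ∑ₙ ξⁿ / n!`, whose inner
products are `⟨e^ξ, e^η⟩ = e^{⟨ξ, η⟩_J}` and which form a total subset of the completed symmetric
algebra. -/
abbrev FockSpace (E : Type*) [NormedAddCommGroup E] [InnerProductSpace ℝ E]
    [FiniteDimensional ℝ E] : Type _ := UniformSpace.Completion (PreFock E)

/-- The coherent vector `e^ξ`. -/
def coherent (ξ : MeanZeroLoops E) : FockSpace E :=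
  ((Finsupp.single ξ 1 : MeanZeroLoops E →₀ ℂ) : PreFock E)

lemma inner_coherent (ξ η : MeanZeroLoops E) :
    inner ℂ (coherent ξ) (coherent η) = Complex.exp (loopHermitian (η : ℝ → E) ξ) := by
  unfold coherent
  rw [UniformSpace.Completion.inner_coe]
  change Finsupp.sum (Finsupp.single ξ (1 : ℂ)) (fun ξ c => Finsupp.sum (Finsupp.single η (1 : ℂ))
    fun η d => star c * Complex.exp (loopHermitian (η : ℝ → E) ξ) * d) = _
  simp

lemma denseRange_coherent :
    DenseRange (Finsupp.linearCombination ℂ (coherent (E := E))) := by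
  refine (UniformSpace.Completion.denseRange_coe (α := PreFock E)).mono ?_
  rintro _ ⟨f, rfl⟩
  refine ⟨(f : MeanZeroLoops E →₀ ℂ), ?_⟩
  have : ∀ f : MeanZeroLoops E →₀ ℂ, Finsupp.linearCombination ℂ (coherent (E := E)) f
      = UniformSpace.Completion.toComplL (𝕜 := ℂ) (E := PreFock E) f := by
    intro f
    induction f using Finsupp.induction_linear with
    | zero => simp; rfl
    | add f g hf hg =>
      rw [map_add, hf, hg]
      exact (map_add (UniformSpace.Completion.toComplL (𝕜 := ℂ) (E := PreFock E)) _ _).symm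
    | single ξ c =>
      rw [Finsupp.linearCombination_single]
      have e : (Finsupp.single ξ c : MeanZeroLoops E →₀ ℂ) = c • Finsupp.single ξ 1 := by simp
      rw [e]
      exact (map_smul (UniformSpace.Completion.toComplL (𝕜 := ℂ) (E := PreFock E)) c _).symm
  exact this f

/-- Two families with the same Gram matrix, the first one total, are related by an isometry. -/
lemma exists_isometry {ι F : Type*} [NormedAddCommGroup F] [InnerProductSpace ℂ F]
    [CompleteSpace F] {u v : ι → F} (hu : DenseRange (Finsupp.linearCombination ℂ u))
    (h : ∀ i j, inner ℂ (v i) (v j) = inner ℂ (u i) (u j)) :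
    ∃ T : F →ₗᵢ[ℂ] F, ∀ i, T (u i) = v i := by
  have hn : ∀ f : ι →₀ ℂ, ‖Finsupp.linearCombination ℂ v f‖ = ‖Finsupp.linearCombination ℂ u f‖ := by
    intro f
    have : inner ℂ (Finsupp.linearCombination ℂ v f) (Finsupp.linearCombination ℂ v f)
        = inner ℂ (Finsupp.linearCombination ℂ u f) (Finsupp.linearCombination ℂ u f) := by
      simp only [Finsupp.linearCombination_apply, Finsupp.sum, sum_inner, inner_sum,
        inner_smul_left, inner_smul_right, h]
    rw [@norm_eq_sqrt_re_inner ℂ, this, ← @norm_eq_sqrt_re_inner ℂ]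
  have hext := LinearMap.extendOfNorm_eq (f := Finsupp.linearCombination ℂ v) hu
    ⟨1, fun f => by rw [one_mul, hn]⟩
  let T := (Finsupp.linearCombination ℂ v).extendOfNorm (Finsupp.linearCombination ℂ u)
  refine ⟨⟨T.toLinearMap, fun x => ?_⟩, fun i => ?_⟩
  · refine hu.induction_on (p := fun x => ‖T x‖ = ‖x‖) x
      (isClosed_eq (T.continuous.norm) continuous_norm) fun f => ?_
    rw [hext, hn]
  · have := hext (Finsupp.single i 1)
    simpa using this

lemma isometry_ext {ι F : Type*} [NormedAddCommGroup F] [InnerProductSpace ℂ F]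
    {u : ι → F} (hu : DenseRange (Finsupp.linearCombination ℂ u))
    {S T : F →ₗᵢ[ℂ] F} (h : ∀ i, S (u i) = T (u i)) : S = T := by
  refine LinearIsometry.ext fun x => ?_
  refine hu.induction_on (p := fun x => S x = T x) x (isClosed_eq S.continuous T.continuous)
    fun f => ?_
  simp [Finsupp.linearCombination_apply, Finsupp.sum, map_sum, h]

/-- The factor `e^{-½⟨ξ,ξ⟩_J - ⟨κ,ξ⟩_J}`. -/
def weylFactor (ξ κ : MeanZeroLoops E) : ℂ :=
  Complex.exp (-(1 / 2) * loopHermitian (ξ : ℝ → E) ξ - loopHermitian (κ : ℝ → E) ξ)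

lemma loopHermitian_add_right {ξ η ζ : ℝ → E} (hξ : ξ ∈ MeanZeroLoops E)
    (hη : η ∈ MeanZeroLoops E) (hζ : ζ ∈ MeanZeroLoops E) :
    loopHermitian ζ (ξ + η) = loopHermitian ζ ξ + loopHermitian ζ η := by
  rw [← loopHermitian_conj (add_mem hξ hη) hζ, loopHermitian_add_left hξ hη hζ, map_add,
    loopHermitian_conj hξ hζ, loopHermitian_conj hη hζ]

lemma exists_weyl (ξ : MeanZeroLoops E) (z : Circle) :
    ∃ T : FockSpace E →ₗᵢ[ℂ] FockSpace E, ∀ κ, T (coherent κ)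
      = ((z : ℂ) * weylFactor ξ κ) • coherent (κ + ξ) := by
  refine exists_isometry denseRange_coherent fun κ μ => ?_
  rw [inner_smul_left, inner_smul_right, inner_coherent, inner_coherent, map_mul]
  have hz : conj (z : ℂ) * z = 1 := by
    rw [← Complex.normSq_eq_conj_mul_self]; simp
  unfold weylFactor
  rw [← Complex.exp_conj]
  have e : ∀ a b c d : ℂ, conj (z : ℂ) * a * ((z : ℂ) * b * c) = a * b * c := fun a b c _ => by
    linear_combination (a * b * c) * hz
  rw [e _ _ _ 0, ← Complex.exp_add, ← Complex.exp_add]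
  congr 1
  simp only [map_sub, map_mul, map_neg, Submodule.coe_add]
  rw [loopHermitian_conj ξ.2 ξ.2, loopHermitian_conj κ.2 ξ.2,
    loopHermitian_add_left μ.2 ξ.2 (add_mem κ.2 ξ.2), loopHermitian_add_right κ.2 ξ.2 μ.2,
    loopHermitian_add_right κ.2 ξ.2 ξ.2]
  have h2 : (starRingEnd ℂ) (1 / 2) = 1 / 2 := by
    have := Complex.conj_ofReal (1 / 2); push_cast at this; exact this
  rw [h2]
  ring

lemma loopForm_skew (ξ η : MeanZeroLoops E) :
    loopHermitian (ξ : ℝ → E) η - loopHermitian (η : ℝ → E) ξ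
      = 2 * (2 * Real.pi * loopForm (ξ : ℝ → E) η : ℝ) * Complex.I := by
  rw [← loopHermitian_conj ξ.2 η.2, Complex.sub_conj, loopHermitian_im]
  push_cast; ring

/-- The operator `W(ξ, z)` as an isometry; see `weyl`. -/
def weylIsometry (ξ : MeanZeroLoops E) (z : Circle) : FockSpace E →ₗᵢ[ℂ] FockSpace E :=
  (exists_weyl ξ z).choose

lemma weylIsometry_coherent (ξ : MeanZeroLoops E) (z : Circle) (κ : MeanZeroLoops E) :
    weylIsometry ξ z (coherent κ) = ((z : ℂ) * weylFactor ξ κ) • coherent (κ + ξ) :=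
  (exists_weyl ξ z).choose_spec κ

lemma weylIsometry_comp (ξ η : MeanZeroLoops E) (z w : Circle) :
    (weylIsometry ξ z).comp (weylIsometry η w) = weylIsometry (ξ + η)
      (z * w * Circle.exp (2 * Real.pi * loopForm (ξ : ℝ → E) η)) := by
  refine isometry_ext denseRange_coherent fun κ => ?_
  rw [LinearIsometry.coe_comp, Function.comp_apply, weylIsometry_coherent, map_smul, weylIsometry_coherent,
    weylIsometry_coherent, smul_smul, add_assoc, add_comm η ξ]
  congr 1
  unfold weylFactor
  have key : Complex.exp (-(1 / 2) * loopHermitian (η : ℝ → E) η - loopHermitian (κ : ℝ → E) η) *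
     Complex.exp (-(1 / 2) * loopHermitian (ξ : ℝ → E) ξ
        - loopHermitian ((κ + η : MeanZeroLoops E) : ℝ → E) ξ)
     = Complex.exp ((2 * Real.pi * loopForm (ξ : ℝ → E) η : ℝ) * Complex.I) *
      Complex.exp (-(1 / 2) * loopHermitian ((ξ + η : MeanZeroLoops E) : ℝ → E)
        ((ξ + η : MeanZeroLoops E) : ℝ → E)
        - loopHermitian (κ : ℝ → E) ((ξ + η : MeanZeroLoops E) : ℝ → E)) := by
    rw [← Complex.exp_add, ← Complex.exp_add]
    congr 1
    simp only [Submodule.coe_add]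
    rw [loopHermitian_add_left κ.2 η.2 ξ.2, loopHermitian_add_left ξ.2 η.2 (add_mem ξ.2 η.2),
      loopHermitian_add_right ξ.2 η.2 ξ.2, loopHermitian_add_right ξ.2 η.2 η.2,
      loopHermitian_add_right ξ.2 η.2 κ.2]
    linear_combination (1 / 2) * loopForm_skew ξ η
  rw [Circle.coe_mul, Circle.coe_mul, Circle.coe_exp]
  linear_combination (z * w : ℂ) * key

lemma weylIsometry_zero : weylIsometry (0 : MeanZeroLoops E) 1 = LinearIsometry.id := by
  refine isometry_ext denseRange_coherent fun κ => ?_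
  rw [weylIsometry_coherent]
  have h0 : ∀ κ : MeanZeroLoops E, loopHermitian (κ : ℝ → E) ((0 : MeanZeroLoops E) : ℝ → E) = 0 := by
    intro κ
    have := loopHermitian_add_right (0 : MeanZeroLoops E).2 (0 : MeanZeroLoops E).2 κ.2
    simpa using this
  simp only [weylFactor, h0]
  simp [one_smul]

lemma loopForm_self (ξ : MeanZeroLoops E) : loopForm (ξ : ℝ → E) ξ = 0 := by
  have := loopForm_skew ξ ξ
  rw [sub_self] at this
  have h := Real.pi_ne_zero
  simpa [h] using this.symm

lemma loopForm_neg_right (ξ η : ℝ → E) : loopForm ξ (-η) = -loopForm ξ η := by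
  simp [loopForm]

lemma loopForm_neg_left (ξ η : ℝ → E) : loopForm (-ξ) η = -loopForm ξ η := by
  have : deriv (-ξ) = -deriv ξ := by ext t; exact deriv.neg
  simp [loopForm, this]

/-- The Weyl operator: the unique unitary operator of Fock space with
`W(ξ, z) e^κ = z e^{-½⟨ξ,ξ⟩_J - ⟨κ,ξ⟩_J} e^{κ+ξ}`. -/
def weyl (ξ : MeanZeroLoops E) (z : Circle) : FockSpace E ≃ₗᵢ[ℂ] FockSpace E where
  toLinearEquiv := LinearEquiv.ofLinearMap (weylIsometry ξ z).toLinearMap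
    (weylIsometry (-ξ) z⁻¹).toLinearMap
    (by
      have := weylIsometry_comp ξ (-ξ) z z⁻¹
      rw [Submodule.coe_neg, loopForm_neg_right, loopForm_self] at this
      simp only [add_neg_cancel, mul_inv_cancel, neg_zero, mul_zero, Circle.exp_zero, mul_one,
        weylIsometry_zero] at this
      exact congrArg LinearIsometry.toLinearMap this)
    (by
      have := weylIsometry_comp (-ξ) ξ z⁻¹ z
      rw [Submodule.coe_neg, loopForm_neg_left, loopForm_self] at this
      simp only [neg_add_cancel, inv_mul_cancel, neg_zero, mul_zero, Circle.exp_zero, mul_one,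
        weylIsometry_zero] at this
      exact congrArg LinearIsometry.toLinearMap this)
  norm_map' := (weylIsometry ξ z).norm_map

lemma weyl_coherent (ξ : MeanZeroLoops E) (z : Circle) (κ : MeanZeroLoops E) :
    weyl ξ z (coherent κ) = ((z : ℂ) * weylFactor ξ κ) • coherent (κ + ξ) :=
  weylIsometry_coherent ξ z κ

lemma weyl_mul (ξ η : MeanZeroLoops E) (z w : Circle) :
    weyl ξ z * weyl η w
      = weyl (ξ + η) (z * w * Circle.exp (2 * Real.pi * loopForm (ξ : ℝ → E) η)) := by
  ext x
  exact congrArg (fun T : FockSpace E →ₗᵢ[ℂ] FockSpace E => T x) (weylIsometry_comp ξ η z w)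

/-! ### Gluing smooth functions -/

lemma contDiffOn_of_hasDerivWithinAt {F : Type*} [NormedAddCommGroup F] [NormedSpace ℝ F]
    {s : Set ℝ} (hs : UniqueDiffOn ℝ s) {G : ℕ → ℝ → F}
    (h : ∀ m, ∀ x ∈ s, HasDerivWithinAt (G m) (G (m + 1) x) s x) : ContDiffOn ℝ ∞ (G 0) s := by
  have key : ∀ n : ℕ, ∀ m, ContDiffOn ℝ n (G m) s := by
    intro n
    induction n with
    | zero =>
      intro m
      exact contDiffOn_zero.2 fun x hx => (h m x hx).continuousWithinAt
    | succ n ih =>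
      intro m
      push_cast
      rw [contDiffOn_succ_iff_derivWithin hs]
      refine ⟨fun x hx => (h m x hx).differentiableWithinAt, by simp, ?_⟩
      exact (ih (m + 1)).congr fun x hx => (h m x hx).derivWithin (hs x hx)
  exact contDiffOn_infty.2 fun n => key n 0

lemma hasDerivWithinAt_iter {F : Type*} [NormedAddCommGroup F] [NormedSpace ℝ F]
    {s : Set ℝ} (hs : UniqueDiffOn ℝ s) {f : ℝ → F} (hf : ContDiffOn ℝ ∞ f s) (m : ℕ) {x : ℝ}
    (hx : x ∈ s) :
    HasDerivWithinAt (iteratedDerivWithin m f s) (iteratedDerivWithin (m + 1) f s x) s x := by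
  have := (hf.differentiableOn_iteratedDerivWithin (m := m) (by exact_mod_cast WithTop.coe_lt_top _) hs) x hx
  rw [iteratedDerivWithin_succ]
  exact this.hasDerivWithinAt

/-- Gluing smooth functions whose jets match. -/
lemma exists_glue {F : Type*} [NormedAddCommGroup F] [NormedSpace ℝ F] {a b c : ℝ} (hab : a < b)
    (hbc : b < c) {f g : ℝ → F} (hf : ContDiffOn ℝ ∞ f (Icc a b)) (hg : ContDiffOn ℝ ∞ g (Icc b c))
    (h : ∀ m, iteratedDerivWithin m f (Icc a b) b = iteratedDerivWithin m g (Icc b c) b) :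
    ∃ G : ℕ → ℝ → F, (∀ m, ∀ x ∈ Icc a c, HasDerivWithinAt (G m) (G (m + 1) x) (Icc a c) x) ∧
      (∀ m, ∀ x ∈ Icc a b, G m x = iteratedDerivWithin m f (Icc a b) x) ∧
      (∀ m, ∀ x ∈ Icc b c, G m x = iteratedDerivWithin m g (Icc b c) x) := by
  let G : ℕ → ℝ → F := fun m x => if x ≤ b then iteratedDerivWithin m f (Icc a b) x
    else iteratedDerivWithin m g (Icc b c) x
  have h1 : ∀ m, ∀ x ∈ Icc a b, G m x = iteratedDerivWithin m f (Icc a b) x :=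
    fun m x hx => if_pos hx.2
  have h2 : ∀ m, ∀ x ∈ Icc b c, G m x = iteratedDerivWithin m g (Icc b c) x := fun m x hx => by
    rcases hx.1.eq_or_lt with rfl | hlt
    · exact (if_pos le_rfl).trans (h m)
    · exact if_neg (not_le.2 hlt)
  refine ⟨G, fun m x hx => ?_, h1, h2⟩
  have u1 := uniqueDiffOn_Icc hab
  have u2 := uniqueDiffOn_Icc hbc
  have hU : Icc a c = Icc a b ∪ Icc b c := (Icc_union_Icc_eq_Icc hab.le hbc.le).symm
  have L : ∀ x ∈ Icc a b, HasDerivWithinAt (G m) (G (m + 1) x) (Icc a b) x := fun x hx => by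
    rw [h1 _ _ hx]
    exact (hasDerivWithinAt_iter u1 hf m hx).congr (h1 m) (h1 m x hx)
  have R : ∀ x ∈ Icc b c, HasDerivWithinAt (G m) (G (m + 1) x) (Icc b c) x := fun x hx => by
    rw [h2 _ _ hx]
    exact (hasDerivWithinAt_iter u2 hg m hx).congr (h2 m) (h2 m x hx)
  rcases lt_trichotomy x b with hlt | rfl | hgt
  · refine (L x ⟨hx.1, hlt.le⟩).mono_of_mem_nhdsWithin ?_
    have : Iio b ∈ 𝓝 x := Iio_mem_nhds hlt
    filter_upwards [self_mem_nhdsWithin, mem_nhdsWithin_of_mem_nhds this] with y hy hy'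
    exact ⟨hy.1, le_of_lt hy'⟩
  · rw [hU]
    exact (L x ⟨hab.le, le_rfl⟩).union (R x ⟨le_rfl, hbc.le⟩)
  · refine (R x ⟨hgt.le, hx.2⟩).mono_of_mem_nhdsWithin ?_
    have : Ioi b ∈ 𝓝 x := Ioi_mem_nhds hgt
    filter_upwards [self_mem_nhdsWithin, mem_nhdsWithin_of_mem_nhds this] with y hy hy'
    exact ⟨le_of_lt hy', hy.2⟩

/-- A smooth function on `[0, 1]` whose derivatives agree at the end points extends to a smooth
quasi-periodic function. -/
lemma exists_quasiperiodic {F : Type*} [NormedAddCommGroup F] [NormedSpace ℝ F]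
    {G : ℕ → ℝ → F}
    (hG : ∀ m, ∀ x ∈ Icc (0 : ℝ) 1, HasDerivWithinAt (G m) (G (m + 1) x) (Icc (0 : ℝ) 1) x)
    (h : ∀ m, 1 ≤ m → G m 1 = G m 0) :
    ∃ ξ : ℝ → F, ContDiff ℝ ∞ ξ ∧ (∀ t, ξ (t + 1) = ξ t + (ξ 1 - ξ 0)) ∧
      ∀ t ∈ Icc (0 : ℝ) 1, ξ t = G 0 t := by
  let d : ℕ → F := fun m => G m 1 - G m 0
  let X : ℕ → ℝ → F := fun m t => G m (Int.fract t) + (⌊t⌋ : ℝ) • d m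
  have hd : ∀ m, 1 ≤ m → d m = 0 := fun m hm => sub_eq_zero.2 (h m hm)
  have hX : ∀ m (n : ℤ), ∀ t ∈ Icc (n : ℝ) (n + 1), X m t = G m (t - n) + (n : ℝ) • d m := by
    intro m n t ht
    rcases ht.2.eq_or_lt with rfl | hlt
    · have : ⌊(n : ℝ) + 1⌋ = n + 1 := by simp
      simp only [X, Int.fract, this]
      push_cast
      simp only [sub_self, add_sub_cancel_left, add_smul, one_smul, d]
      abel
    · have : ⌊t⌋ = n := Int.floor_eq_iff.2 ⟨ht.1, hlt⟩
      simp only [X, Int.fract, this]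
  have hder : ∀ m (n : ℤ), ∀ t ∈ Icc (n : ℝ) (n + 1),
      HasDerivWithinAt (X m) (X (m + 1) t) (Icc (n : ℝ) (n + 1)) t := by
    intro m n t ht
    rw [hX _ n t ht, hd (m + 1) (by omega), smul_zero, add_zero]
    have hmap : MapsTo (fun t : ℝ => t - n) (Icc (n : ℝ) (n + 1)) (Icc (0 : ℝ) 1) :=
      fun s hs => ⟨by linarith [hs.1], by linarith [hs.2]⟩
    have h1 := (hG m (t - n) (hmap ht)).scomp t
      (((hasDerivAt_id t).sub_const (n : ℝ)).hasDerivWithinAt (s := Icc (n : ℝ) (n + 1))) hmap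
    rw [one_smul] at h1
    exact (h1.add_const ((n : ℝ) • d m)).congr (fun s hs => hX m n s hs) (hX m n t ht)
  have hder' : ∀ m t, HasDerivAt (X m) (X (m + 1) t) t := by
    intro m t
    have hr : HasDerivWithinAt (X m) (X (m + 1) t) (Ici t) t := by
      refine (hder m ⌊t⌋ t ⟨Int.floor_le t, (Int.lt_floor_add_one t).le⟩).mono_of_mem_nhdsWithin ?_
      refine mem_of_superset (Icc_mem_nhdsGE (Int.lt_floor_add_one t)) ?_
      exact Icc_subset_Icc_left (Int.floor_le t)
    have hl : HasDerivWithinAt (X m) (X (m + 1) t) (Iic t) t := by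
      have a1 : t ≤ ((⌈t⌉ - 1 : ℤ) : ℝ) + 1 := by push_cast; linarith [Int.le_ceil t]
      have a2 : ((⌈t⌉ - 1 : ℤ) : ℝ) < t := by push_cast; linarith [Int.ceil_lt_add_one t]
      refine (hder m (⌈t⌉ - 1) t ⟨a2.le, a1⟩).mono_of_mem_nhdsWithin ?_
      refine mem_of_superset (Icc_mem_nhdsLE a2) ?_
      exact Icc_subset_Icc_right a1
    have := hl.union hr
    rwa [Iic_union_Ici, hasDerivWithinAt_univ] at this
  refine ⟨X 0, ?_, fun t => ?_, fun t ht => ?_⟩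
  · rw [← contDiffOn_univ]
    exact contDiffOn_of_hasDerivWithinAt uniqueDiffOn_univ fun m x _ => (hder' m x).hasDerivWithinAt
  · have e1 := hX 0 0 1 (by norm_num)
    have e0 := hX 0 0 0 (by norm_num)
    simp only [X, Int.fract_add_one, Int.floor_add_one, Int.cast_add, Int.cast_one, add_smul,
      one_smul] at e1 e0 ⊢
    simp [d]
    abel
  · have := hX 0 0 t (by simpa using ht)
    simpa using this

variable {𝔥 𝔱w 𝔱b : Type*} [NormedAddCommGroup 𝔥] [InnerProductSpace ℝ 𝔥] [FiniteDimensional ℝ 𝔥]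
  [NormedAddCommGroup 𝔱w] [InnerProductSpace ℝ 𝔱w] [FiniteDimensional ℝ 𝔱w]
  [NormedAddCommGroup 𝔱b] [InnerProductSpace ℝ 𝔱b] [FiniteDimensional ℝ 𝔱b]

/-! ### Spans of lattices and bicoloured torus loop groups -/

/-- `Λ` is a full lattice in the Euclidean space `V` on which the inner product is even; that is, an
even positive definite lattice of rank `dim V`, with `Λ ⊗ ℝ = V`. -/
structure IsEvenLattice {V : Type*} [NormedAddCommGroup V] [InnerProductSpace ℝ V]
    (Λ : AddSubgroup V) : Prop where
  discrete : DiscreteTopology Λ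
  span_eq_top : Submodule.span ℝ (Λ : Set V) = ⊤
  even : ∀ x ∈ Λ, ∃ n : ℤ, ⟪x, x⟫ = 2 * n

/-- Even positive definite lattices `Γ`, `Λw`, `Λb` of the same finite rank, with `𝔥 = Γ ⊗ ℝ`,
`𝔱w = Λw ⊗ ℝ`, `𝔱b = Λb ⊗ ℝ`, and lattice morphisms `Γ → Λw`, `Γ → Λb`, given through their (form
preserving, hence bijective) real extensions `πw`, `πb`. -/
structure LatticeSpan (𝔥 𝔱w 𝔱b : Type*) [NormedAddCommGroup 𝔥] [InnerProductSpace ℝ 𝔥]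
    [NormedAddCommGroup 𝔱w] [InnerProductSpace ℝ 𝔱w]
    [NormedAddCommGroup 𝔱b] [InnerProductSpace ℝ 𝔱b] where
  Γ : AddSubgroup 𝔥
  Λw : AddSubgroup 𝔱w
  Λb : AddSubgroup 𝔱b
  isLattice_Γ : IsEvenLattice Γ
  isLattice_Λw : IsEvenLattice Λw
  isLattice_Λb : IsEvenLattice Λb
  πw : 𝔥 ≃ₗᵢ[ℝ] 𝔱w
  πb : 𝔥 ≃ₗᵢ[ℝ] 𝔱b
  map_w : ∀ x ∈ Γ, πw x ∈ Λw
  map_b : ∀ x ∈ Γ, πb x ∈ Λb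

namespace LatticeSpan

variable (S : LatticeSpan 𝔥 𝔱w 𝔱b)

/-- The torus `H = 𝔥 / Γ`. -/
abbrev H : Type _ := 𝔥 ⧸ S.Γ

/-- The torus `T_w = 𝔱w / Λw`. -/
abbrev Tw : Type _ := 𝔱w ⧸ S.Λw

/-- The torus `T_b = 𝔱b / Λb`. -/
abbrev Tb : Type _ := 𝔱b ⧸ S.Λb

/-- The homomorphism `H → T_w` induced by `πw`. -/
def torusMapW : S.H →+ S.Tw :=
  QuotientAddGroup.map S.Γ S.Λw S.πw.toLinearEquiv.toAddEquiv.toAddMonoidHom S.map_w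

/-- The homomorphism `H → T_b` induced by `πb`. -/
def torusMapB : S.H →+ S.Tb :=
  QuotientAddGroup.map S.Γ S.Λb S.πb.toLinearEquiv.toAddEquiv.toAddMonoidHom S.map_b

/-- `Λw` regarded inside `𝔥`. -/
def latW : AddSubgroup 𝔥 := S.Λw.comap S.πw.toLinearEquiv.toAddEquiv.toAddMonoidHom

/-- `Λb` regarded inside `𝔥`. -/
def latB : AddSubgroup 𝔥 := S.Λb.comap S.πb.toLinearEquiv.toAddEquiv.toAddMonoidHom

/-- `Λw ∩ Λb ⊆ 𝔥`. -/
def inter : AddSubgroup 𝔥 := S.latW ⊓ S.latB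

/-- `Λw - Λb ⊆ 𝔥`, the set of all differences. -/
def diff : AddSubgroup 𝔥 where
  carrier := {x | ∃ lw ∈ S.latW, ∃ lb ∈ S.latB, x = lw - lb}
  zero_mem' := ⟨0, zero_mem _, 0, zero_mem _, by simp⟩
  add_mem' := by
    rintro _ _ ⟨a, ha, b, hb, rfl⟩ ⟨c, hc, d, hd, rfl⟩
    exact ⟨a + c, add_mem ha hc, b + d, add_mem hb hd, by abel⟩
  neg_mem' := by
    rintro _ ⟨a, ha, b, hb, rfl⟩
    exact ⟨-a, neg_mem ha, -b, neg_mem hb, by abel⟩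

/-- Triples `(γ_w, γ_m, γ_b)` of maps (no smoothness or matching conditions). The circle is `ℝ/ℤ`, with
the point `q` at `0 = 1` and the point `p` at `1/2`; the black arc from `q` to `p` is `[0, 1/2]` and the
white arc from `p` to `q` is `[1/2, 1]`. The middle component consists of the values at `p` and `q`. -/
abbrev Triple : Type _ :=
  (Icc (1 / 2 : ℝ) 1 → S.Tw) × (S.H × S.H) × (Icc (0 : ℝ) (1 / 2) → S.Tb)

variable {S}
namespace Triple
variable (γ : S.Triple)
/-- The white component. -/
def white (t : ℝ) (ht : t ∈ Icc (1 / 2 : ℝ) 1) : S.Tw := γ.1 ⟨t, ht⟩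

/-- The black component. -/
def black (t : ℝ) (ht : t ∈ Icc (0 : ℝ) (1 / 2)) : S.Tb := γ.2.2 ⟨t, ht⟩

/-- `γ_m(p)`. -/
def atP : S.H := γ.2.1.1

/-- `γ_m(q)`. -/
def atQ : S.H := γ.2.1.2
end Triple
variable (S)

/-- The conditions on a triple to be an element of `L(T_w, H, T_b)`: the values match at `p` and `q`, the
two arcs are smooth (that is, have smooth lifts to `𝔱w` and `𝔱b`), and all their derivatives of order
at least one, transported to `𝔥`, agree at `p` and at `q`. -/
structure IsBicoloured (γ : S.Triple) : Prop where
  white_p : γ.white (1 / 2) (by norm_num) = S.torusMapW γ.atP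
  white_q : γ.white 1 (by norm_num) = S.torusMapW γ.atQ
  black_p : γ.black (1 / 2) (by norm_num) = S.torusMapB γ.atP
  black_q : γ.black 0 (by norm_num) = S.torusMapB γ.atQ
  smooth : ∃ (fw : ℝ → 𝔱w) (fb : ℝ → 𝔱b),
    ContDiffOn ℝ ∞ fw (Icc (1 / 2) 1) ∧ ContDiffOn ℝ ∞ fb (Icc 0 (1 / 2)) ∧
    (∀ t ht, γ.white t ht = QuotientAddGroup.mk (fw t)) ∧
    (∀ t ht, γ.black t ht = QuotientAddGroup.mk (fb t)) ∧
    (∀ k : ℕ, 1 ≤ k →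
      S.πw.symm (iteratedDerivWithin k fw (Icc (1 / 2) 1) (1 / 2))
        = S.πb.symm (iteratedDerivWithin k fb (Icc 0 (1 / 2)) (1 / 2))) ∧
    (∀ k : ℕ, 1 ≤ k →
      S.πw.symm (iteratedDerivWithin k fw (Icc (1 / 2) 1) 1)
        = S.πb.symm (iteratedDerivWithin k fb (Icc 0 (1 / 2)) 0))

lemma uniqueDiffOn_w : UniqueDiffOn ℝ (Icc (1 / 2 : ℝ) 1) := uniqueDiffOn_Icc (by norm_num)
lemma uniqueDiffOn_b : UniqueDiffOn ℝ (Icc (0 : ℝ) (1 / 2)) := uniqueDiffOn_Icc (by norm_num)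

/-- The bicoloured torus loop group `L(T_w, H, T_b)`, under pointwise addition. -/
def loopGroup : AddSubgroup S.Triple where
  carrier := {γ | S.IsBicoloured γ}
  zero_mem' :=
    { white_p := (map_zero S.torusMapW).symm
      white_q := (map_zero S.torusMapW).symm
      black_p := (map_zero S.torusMapB).symm
      black_q := (map_zero S.torusMapB).symm
      smooth := ⟨0, 0, contDiffOn_const, contDiffOn_const, fun _ _ => rfl, fun _ _ => rfl,
        fun k _ => by simp, fun k _ => by simp⟩ }
  add_mem' := by
    rintro γ ρ hγ hρ
    obtain ⟨fw, fb, a1, a2, a3, a4, a5, a6⟩ := hγ.smooth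
    obtain ⟨gw, gb, b1, b2, b3, b4, b5, b6⟩ := hρ.smooth
    have hw : ∀ (k : ℕ), ∀ t ∈ Icc (1 / 2 : ℝ) 1, iteratedDerivWithin k (fw + gw) (Icc (1 / 2) 1) t
        = iteratedDerivWithin k fw (Icc (1 / 2) 1) t + iteratedDerivWithin k gw (Icc (1 / 2) 1) t :=
      fun k t ht => iteratedDerivWithin_add ht uniqueDiffOn_w
        ((contDiffOn_infty.1 a1 k) t ht) ((contDiffOn_infty.1 b1 k) t ht)
    have hb : ∀ (k : ℕ), ∀ t ∈ Icc (0 : ℝ) (1 / 2), iteratedDerivWithin k (fb + gb) (Icc 0 (1 / 2)) t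
        = iteratedDerivWithin k fb (Icc 0 (1 / 2)) t + iteratedDerivWithin k gb (Icc 0 (1 / 2)) t :=
      fun k t ht => iteratedDerivWithin_add ht uniqueDiffOn_b
        ((contDiffOn_infty.1 a2 k) t ht) ((contDiffOn_infty.1 b2 k) t ht)
    exact
    { white_p := (congrArg₂ (· + ·) hγ.white_p hρ.white_p).trans (map_add S.torusMapW _ _).symm
      white_q := (congrArg₂ (· + ·) hγ.white_q hρ.white_q).trans (map_add S.torusMapW _ _).symm
      black_p := (congrArg₂ (· + ·) hγ.black_p hρ.black_p).trans (map_add S.torusMapB _ _).symm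
      black_q := (congrArg₂ (· + ·) hγ.black_q hρ.black_q).trans (map_add S.torusMapB _ _).symm
      smooth := ⟨fw + gw, fb + gb, a1.add b1, a2.add b2,
        fun t ht => congrArg₂ (· + ·) (a3 t ht) (b3 t ht),
        fun t ht => congrArg₂ (· + ·) (a4 t ht) (b4 t ht),
        fun k hk => by
          rw [hw k _ (by norm_num), hb k _ (by norm_num), map_add, map_add, a5 k hk, b5 k hk],
        fun k hk => by
          rw [hw k _ (by norm_num), hb k _ (by norm_num), map_add, map_add, a6 k hk, b6 k hk]⟩ }
  neg_mem' := by
    rintro γ hγ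
    obtain ⟨fw, fb, a1, a2, a3, a4, a5, a6⟩ := hγ.smooth
    exact
    { white_p := (congrArg Neg.neg hγ.white_p).trans (map_neg S.torusMapW _).symm
      white_q := (congrArg Neg.neg hγ.white_q).trans (map_neg S.torusMapW _).symm
      black_p := (congrArg Neg.neg hγ.black_p).trans (map_neg S.torusMapB _).symm
      black_q := (congrArg Neg.neg hγ.black_q).trans (map_neg S.torusMapB _).symm
      smooth := ⟨-fw, -fb, a1.neg, a2.neg,
        fun t ht => congrArg Neg.neg (a3 t ht),
        fun t ht => congrArg Neg.neg (a4 t ht),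
        fun k hk => by
          rw [iteratedDerivWithin_neg, iteratedDerivWithin_neg, map_neg, map_neg, a5 k hk],
        fun k hk => by
          rw [iteratedDerivWithin_neg, iteratedDerivWithin_neg, map_neg, map_neg, a6 k hk]⟩ }

/-- `ξ` is a lift to `𝔥` of the path `Pth γ : [0, 1] → H` that is obtained by lifting `γ_b` and `γ_w` to
`H` with the value `γ_m(p)` at `p` and gluing the results at `p`; the lift is extended from `[0, 1]` to a
smooth quasi-periodic function on `ℝ`. It is unique up to adding an element of `Γ`. -/
structure IsLift (γ : S.Triple) (ξ : ℝ → 𝔥) : Prop where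
  smooth : ContDiff ℝ ∞ ξ
  quasi : ∀ t, ξ (t + 1) = ξ t + (ξ 1 - ξ 0)
  at_p : QuotientAddGroup.mk (ξ (1 / 2)) = γ.atP
  white : ∀ t ht, QuotientAddGroup.mk (S.πw (ξ t)) = γ.white t ht
  black : ∀ t ht, QuotientAddGroup.mk (S.πb (ξ t)) = γ.black t ht

variable {S}

lemma IsLift.add {γ ρ : S.Triple} {ξ η : ℝ → 𝔥} (h : S.IsLift γ ξ) (k : S.IsLift ρ η) :
    S.IsLift (γ + ρ) (ξ + η) where
  smooth := h.smooth.add k.smooth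
  quasi t := by simp only [Pi.add_apply, h.quasi t, k.quasi t]; abel
  at_p := congrArg₂ (· + ·) h.at_p k.at_p
  white t ht := by
    refine Eq.trans ?_ (congrArg₂ (· + ·) (h.white t ht) (k.white t ht))
    simp
  black t ht := by
    refine Eq.trans ?_ (congrArg₂ (· + ·) (h.black t ht) (k.black t ht))
    simp

lemma IsLift.zero : S.IsLift 0 0 where
  smooth := contDiff_const
  quasi t := by simp
  at_p := rfl
  white t ht := by simp; rfl
  black t ht := by simp; rfl

lemma continuous_eq_of_discrete {V : Type*} [NormedAddCommGroup V] {Λ : AddSubgroup V}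
    (hΛ : DiscreteTopology Λ) {a b : ℝ} {f : ℝ → V} (hf : Continuous f)
    (h : ∀ t ∈ Icc a b, f t ∈ Λ) {s t : ℝ} (hs : s ∈ Icc a b) (ht : t ∈ Icc a b) : f s = f t :=
  isPreconnected_Icc.constant_of_mapsTo (isDiscrete_iff_discreteTopology.2 hΛ)
    hf.continuousOn h hs ht

/-- Two lifts differ by a constant in `Γ`. -/
lemma IsLift.unique {γ : S.Triple} {ξ η : ℝ → 𝔥} (h : S.IsLift γ ξ) (k : S.IsLift γ η) :
    ∃ v ∈ S.Γ, ∀ t, η t = ξ t + v := by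
  have hv : η (1 / 2) - ξ (1 / 2) ∈ S.Γ := by
    have := QuotientAddGroup.eq.1 (h.at_p.trans k.at_p.symm)
    rwa [neg_add_eq_sub] at this
  have hw : ∀ t ∈ Icc (1 / 2 : ℝ) 1, η t - ξ t = η (1 / 2) - ξ (1 / 2) := fun t ht => by
    have := continuous_eq_of_discrete S.isLattice_Λw.discrete (a := 1 / 2) (b := 1)
      (f := fun t => S.πw (η t) - S.πw (ξ t))
      ((S.πw.continuous.comp k.smooth.continuous).sub (S.πw.continuous.comp h.smooth.continuous))
      (fun t ht => by
        have := QuotientAddGroup.eq.1 ((h.white t ht).trans (k.white t ht).symm)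
        rwa [neg_add_eq_sub] at this) ht (show (1 / 2 : ℝ) ∈ _ by norm_num)
    simp only [← map_sub] at this
    exact S.πw.injective this
  have hb : ∀ t ∈ Icc (0 : ℝ) (1 / 2), η t - ξ t = η (1 / 2) - ξ (1 / 2) := fun t ht => by
    have := continuous_eq_of_discrete S.isLattice_Λb.discrete (a := 0) (b := 1 / 2)
      (f := fun t => S.πb (η t) - S.πb (ξ t))
      ((S.πb.continuous.comp k.smooth.continuous).sub (S.πb.continuous.comp h.smooth.continuous))
      (fun t ht => by
        have := QuotientAddGroup.eq.1 ((h.black t ht).trans (k.black t ht).symm)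
        rwa [neg_add_eq_sub] at this) ht (show (1 / 2 : ℝ) ∈ _ by norm_num)
    simp only [← map_sub] at this
    exact S.πb.injective this
  have h01 : ∀ t ∈ Icc (0 : ℝ) 1, η t - ξ t = η (1 / 2) - ξ (1 / 2) := fun t ht => by
    rcases le_total t (1 / 2) with h2 | h2
    · exact hb t ⟨ht.1, h2⟩
    · exact hw t ⟨h2, ht.2⟩
  have hper : Function.Periodic (fun t => η t - ξ t) 1 := fun t => by
    have e : η 1 - η 0 = ξ 1 - ξ 0 := by
      have := (h01 1 (by norm_num)).trans (h01 0 (by norm_num)).symm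
      rw [sub_eq_sub_iff_add_eq_add] at this ⊢
      rw [this, add_comm]
    simp only [h.quasi t, k.quasi t, e]
    abel
  refine ⟨_, hv, fun t => ?_⟩
  have e1 : η t - ξ t = η (Int.fract t) - ξ (Int.fract t) := by
    have := hper.sub_int_mul_eq (x := t) ⌊t⌋
    simp only [mul_one] at this
    exact this.symm
  rw [h01 _ ⟨Int.fract_nonneg t, (Int.fract_lt_one t).le⟩] at e1
  rw [← e1]; abel

lemma IsBicoloured.exists_lift {γ : S.Triple} (h : S.IsBicoloured γ) : ∃ ξ, S.IsLift γ ξ := by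
  obtain ⟨fw, fb, a1, a2, a3, a4, a5, a6⟩ := h.smooth
  obtain ⟨x, hx⟩ := QuotientAddGroup.mk_surjective γ.atP
  let f : ℝ → 𝔥 := fun t => (x - S.πb.symm (fb (1 / 2))) + S.πb.symm (fb t)
  let g : ℝ → 𝔥 := fun t => (x - S.πw.symm (fw (1 / 2))) + S.πw.symm (fw t)
  have hf : ContDiffOn ℝ ∞ f (Icc 0 (1 / 2)) :=
    contDiffOn_const.add (S.πb.symm.contDiff.comp_contDiffOn a2)
  have hg : ContDiffOn ℝ ∞ g (Icc (1 / 2) 1) :=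
    contDiffOn_const.add (S.πw.symm.contDiff.comp_contDiffOn a1)
  have df : ∀ k : ℕ, 1 ≤ k → ∀ t ∈ Icc (0 : ℝ) (1 / 2), iteratedDerivWithin k f (Icc 0 (1 / 2)) t
      = S.πb.symm (iteratedDerivWithin k fb (Icc 0 (1 / 2)) t) := fun k hk t ht => by
    have e := iteratedDerivWithin_const_add (s := Icc (0 : ℝ) (1 / 2)) (x := t)
      (f := fun t => S.πb.symm (fb t)) hk (x - S.πb.symm (fb (1 / 2)))
    rw [e, iteratedDerivWithin, iteratedDerivWithin]
    have := S.πb.symm.toContinuousLinearEquiv.iteratedFDerivWithin_comp_left fb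
      uniqueDiffOn_b ht k
    exact congrArg (fun T => T fun _ => 1) this
  have dg : ∀ k : ℕ, 1 ≤ k → ∀ t ∈ Icc (1 / 2 : ℝ) 1, iteratedDerivWithin k g (Icc (1 / 2) 1) t
      = S.πw.symm (iteratedDerivWithin k fw (Icc (1 / 2) 1) t) := fun k hk t ht => by
    have e := iteratedDerivWithin_const_add (s := Icc (1 / 2 : ℝ) 1) (x := t)
      (f := fun t => S.πw.symm (fw t)) hk (x - S.πw.symm (fw (1 / 2)))
    rw [e, iteratedDerivWithin, iteratedDerivWithin]
    have := S.πw.symm.toContinuousLinearEquiv.iteratedFDerivWithin_comp_left fw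
      uniqueDiffOn_w ht k
    exact congrArg (fun T => T fun _ => 1) this
  obtain ⟨G, hG, Gf, Gg⟩ := exists_glue (a := 0) (b := 1 / 2) (c := 1) (by norm_num) (by norm_num)
    hf hg (fun m => by
      rcases Nat.eq_zero_or_pos m with rfl | hm
      · simp [f, g]
      · rw [df m hm _ (by norm_num), dg m hm _ (by norm_num), a5 m hm])
  obtain ⟨ξ, h1, h2, h3⟩ := exists_quasiperiodic hG (fun m hm => by
    rw [Gg m 1 (by norm_num), Gf m 0 (by norm_num), df m hm _ (by norm_num),
      dg m hm _ (by norm_num), a6 m hm])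
  have ξf : ∀ t ∈ Icc (0 : ℝ) (1 / 2), ξ t = f t := fun t ht => by
    rw [h3 t ⟨ht.1, ht.2.trans (by norm_num)⟩, Gf 0 t ht, iteratedDerivWithin_zero]
  have ξg : ∀ t ∈ Icc (1 / 2 : ℝ) 1, ξ t = g t := fun t ht => by
    rw [h3 t ⟨le_trans (by norm_num) ht.1, ht.2⟩, Gg 0 t ht, iteratedDerivWithin_zero]
  refine ⟨ξ, h1, h2, ?_, fun t ht => ?_, fun t ht => ?_⟩
  · rw [ξf _ (by norm_num), ← hx]
    simp [f]
  · rw [ξg t ht, a3 t ht, QuotientAddGroup.eq]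
    have := h.white_p
    rw [a3, ← hx] at this
    have := QuotientAddGroup.eq.1 this.symm
    simp only [g, map_add, map_sub, LinearIsometryEquiv.apply_symm_apply]
    convert this using 1
    change _ = -(S.πw x) + _
    abel
  · rw [ξf t ht, a4 t ht, QuotientAddGroup.eq]
    have := h.black_p
    rw [a4, ← hx] at this
    have := QuotientAddGroup.eq.1 this.symm
    simp only [f, map_add, map_sub, LinearIsometryEquiv.apply_symm_apply]
    convert this using 1
    change _ = -(S.πb x) + _
    abel

/-- A choice of a lift of `Pth γ`. -/
def lift (γ : S.loopGroup) : ℝ → 𝔥 := (IsBicoloured.exists_lift γ.2).choose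

lemma isLift_lift (γ : S.loopGroup) : S.IsLift γ (lift γ) :=
  (IsBicoloured.exists_lift γ.2).choose_spec

lemma IsLift.sub_mem_diff {γ : S.Triple} (hγ : S.IsBicoloured γ) {ξ : ℝ → 𝔥}
    (h : S.IsLift γ ξ) : ξ 1 - ξ 0 ∈ S.diff := by
  obtain ⟨x, hx⟩ := QuotientAddGroup.mk_surjective γ.atQ
  refine ⟨ξ 1 - x, ?_, ξ 0 - x, ?_, by abel⟩
  · have := (h.white 1 (by norm_num)).trans hγ.white_q
    rw [← hx] at this
    have := QuotientAddGroup.eq.1 this.symm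
    change S.πw (ξ 1 - x) ∈ S.Λw
    rw [map_sub, ← neg_add_eq_sub]
    exact this
  · have := (h.black 0 (by norm_num)).trans hγ.black_q
    rw [← hx] at this
    have := QuotientAddGroup.eq.1 this.symm
    change S.πb (ξ 0 - x) ∈ S.Λb
    rw [map_sub, ← neg_add_eq_sub]
    exact this

/-- The homomorphism `Δ' ∘ Pth : L(T_w, H, T_b) → Λw - Λb`, `γ ↦ ξ(1) - ξ(0)`. -/
def disp : S.loopGroup →+ S.diff where
  toFun γ := ⟨lift γ 1 - lift γ 0, (isLift_lift γ).sub_mem_diff γ.2⟩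
  map_zero' := by
    obtain ⟨v, -, hv⟩ := IsLift.unique (IsLift.zero (S := S)) (isLift_lift (0 : S.loopGroup))
    ext
    simp [hv]
  map_add' γ ρ := by
    obtain ⟨v, -, hv⟩ := ((isLift_lift γ).add (isLift_lift ρ)).unique (isLift_lift (γ + ρ))
    ext
    simp [hv]
    abel

lemma disp_eq (γ : S.loopGroup) {ξ : ℝ → 𝔥} (h : S.IsLift γ ξ) :
    (disp γ : 𝔥) = ξ 1 - ξ 0 := by
  obtain ⟨v, -, hv⟩ := h.unique (isLift_lift γ)
  change lift γ 1 - lift γ 0 = _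
  simp [hv]

/-! ### The central extension -/

/-- The form `S'(ξ, η) = ½ ∫₀¹ ⟨ξ', η⟩ + ½ ⟨ξ(1) - ξ(0), η(0)⟩`. -/
def pathForm (ξ η : ℝ → 𝔥) : ℝ := loopForm ξ η + (1 / 2) * ⟪ξ 1 - ξ 0, η 0⟫

lemma loopForm_add_left {ξ ξ' η : ℝ → 𝔥} (h : ContDiff ℝ ∞ ξ) (h' : ContDiff ℝ ∞ ξ')
    (k : ContDiff ℝ ∞ η) : loopForm (ξ + ξ') η = loopForm ξ η + loopForm ξ' η := by
  have c1 := h.continuous_deriv (by simp)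
  have c2 := h'.continuous_deriv (by simp)
  have c3 := k.continuous
  unfold loopForm
  rw [← mul_add, ← intervalIntegral.integral_add (by apply Continuous.intervalIntegrable; fun_prop)
    (by apply Continuous.intervalIntegrable; fun_prop)]
  congr 2; ext t
  have := deriv_add ((h.differentiable (by simp)) t) ((h'.differentiable (by simp)) t)
  rw [this, inner_add_left]

lemma loopForm_add_right {ξ η η' : ℝ → 𝔥} (h : ContDiff ℝ ∞ ξ) (k : ContDiff ℝ ∞ η)
    (k' : ContDiff ℝ ∞ η') : loopForm ξ (η + η') = loopForm ξ η + loopForm ξ η' := by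
  have c1 := h.continuous_deriv (by simp)
  have c2 := k.continuous
  have c3 := k'.continuous
  unfold loopForm
  rw [← mul_add, ← intervalIntegral.integral_add (by apply Continuous.intervalIntegrable; fun_prop)
    (by apply Continuous.intervalIntegrable; fun_prop)]
  congr 2; ext t
  rw [Pi.add_apply, inner_add_right]

lemma pathForm_add_left {ξ ξ' η : ℝ → 𝔥} (h : ContDiff ℝ ∞ ξ) (h' : ContDiff ℝ ∞ ξ')
    (k : ContDiff ℝ ∞ η) : pathForm (ξ + ξ') η = pathForm ξ η + pathForm ξ' η := by
  simp only [pathForm, loopForm_add_left h h' k, Pi.add_apply, inner_sub_left, inner_add_left]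
  ring

lemma pathForm_add_right {ξ η η' : ℝ → 𝔥} (h : ContDiff ℝ ∞ ξ) (k : ContDiff ℝ ∞ η)
    (k' : ContDiff ℝ ∞ η') : pathForm ξ (η + η') = pathForm ξ η + pathForm ξ η' := by
  simp only [pathForm, loopForm_add_right h k k', Pi.add_apply, inner_add_right]
  ring

lemma loopForm_const_left (v : 𝔥) (η : ℝ → 𝔥) : loopForm (fun _ => v) η = 0 := by
  simp [loopForm]

lemma loopForm_const_right {ξ : ℝ → 𝔥} (h : ContDiff ℝ ∞ ξ) (v : 𝔥) :
    loopForm ξ (fun _ => v) = (1 / 2) * ⟪ξ 1 - ξ 0, v⟫ := by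
  unfold loopForm
  congr 1
  have c1 := h.continuous_deriv (by simp)
  have := (innerSL ℝ v).intervalIntegral_comp_comm (μ := volume) (a := 0) (b := 1)
    (c1.intervalIntegrable 0 1)
  rw [intervalIntegral.integral_deriv_eq_sub (fun t _ => (h.differentiable (by simp)) t)
    (c1.intervalIntegrable _ _)] at this
  simp only [innerSL_apply_apply] at this
  rw [real_inner_comm, ← this]
  congr 1; ext t
  rw [real_inner_comm]

variable {S : LatticeSpan 𝔥 𝔱w 𝔱b}

lemma inner_int {V : Type*} [NormedAddCommGroup V] [InnerProductSpace ℝ V]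
    {Λ : AddSubgroup V} (hΛ : IsEvenLattice Λ) {x y : V} (hx : x ∈ Λ) (hy : y ∈ Λ) :
    ∃ n : ℤ, ⟪x, y⟫ = n := by
  obtain ⟨a, ha⟩ := hΛ.even _ hx
  obtain ⟨b, hb⟩ := hΛ.even _ hy
  obtain ⟨c, hc⟩ := hΛ.even _ (add_mem hx hy)
  refine ⟨c - a - b, ?_⟩
  rw [real_inner_add_add_self] at hc
  push_cast
  linarith

lemma inner_diff_int {x v : 𝔥} (hx : x ∈ S.diff) (hv : v ∈ S.Γ) : ∃ n : ℤ, ⟪x, v⟫ = n := by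
  obtain ⟨a, ha, b, hb, rfl⟩ := hx
  obtain ⟨m, hm⟩ := inner_int S.isLattice_Λw ha (S.map_w v hv)
  obtain ⟨n, hn⟩ := inner_int S.isLattice_Λb hb (S.map_b v hv)
  refine ⟨m - n, ?_⟩
  have h1 : ⟪a, v⟫ = m := (S.πw.inner_map_map a v).symm.trans hm
  have h2 : ⟪b, v⟫ = n := (S.πb.inner_map_map b v).symm.trans hn
  rw [inner_sub_left, h1, h2]; push_cast; ring

lemma exp_int (n : ℤ) : Circle.exp (2 * Real.pi * n) = 1 := by
  rw [mul_comm]; exact Circle.exp_int_mul_two_pi n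

lemma exp_pathForm_eq {γ ρ : S.loopGroup} {ξ ξ' η η' : ℝ → 𝔥} (h : S.IsLift γ ξ)
    (h' : S.IsLift γ ξ') (k : S.IsLift ρ η) (k' : S.IsLift ρ η') :
    Circle.exp (2 * Real.pi * pathForm ξ' η') = Circle.exp (2 * Real.pi * pathForm ξ η) := by
  obtain ⟨v, -, hv⟩ := h.unique h'
  obtain ⟨w, hw, hw'⟩ := k.unique k'
  have e1 : ξ' = ξ + fun _ => v := funext hv
  have e2 : η' = η + fun _ => w := funext hw'
  obtain ⟨n, hn⟩ := inner_diff_int (h.sub_mem_diff γ.2) hw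
  have e : pathForm ξ' η' = pathForm ξ η + n := by
    have k1 : ContDiff ℝ ∞ (η + fun _ => w) := k.smooth.add contDiff_const
    rw [e1, e2, pathForm_add_left h.smooth contDiff_const k1,
      pathForm_add_right h.smooth k.smooth contDiff_const]
    simp only [pathForm, loopForm_const_left, loopForm_const_right h.smooth, hn, sub_self,
      inner_zero_left]
    ring
  rw [e, mul_add, Circle.exp_add, exp_int, mul_one]

variable (S)

/-- A normalised `2`-cocycle `ε` on `Λw - Λb` with values in the circle group whose commutator map is
`(λ, μ) ↦ e^{2πi (½⟨μ, λ⟩ + ⟨μ, λ_b⟩)}` for `λ = λ_w - λ_b`. -/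
structure TwistCocycle where
  toFun : S.diff → S.diff → Circle
  zero_left : ∀ μ, toFun 0 μ = 1
  zero_right : ∀ μ, toFun μ 0 = 1
  assoc : ∀ l μ ν, toFun l μ * toFun (l + μ) ν = toFun μ ν * toFun l (μ + ν)
  commutator : ∀ (l μ : S.diff), ∀ lw ∈ S.latW, ∀ lb ∈ S.latB, (l : 𝔥) = lw - lb →
    toFun l μ * (toFun μ l)⁻¹
      = Circle.exp (2 * Real.pi * ((1 / 2) * ⟪(μ : 𝔥), l⟫ + ⟪(μ : 𝔥), lb⟫))

variable {S}

/-- The cocycle `c(γ, ρ) = ε(Δ'γ, Δ'ρ) e^{2πi S'(ξ, η)}`, with `ξ`, `η` lifts of `Pth γ`, `Pth ρ`. -/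
def loopCocycle (ε : S.TwistCocycle) (γ ρ : S.loopGroup) : Circle :=
  ε.toFun (disp γ) (disp ρ) * Circle.exp (2 * Real.pi * pathForm (lift γ) (lift ρ))

lemma loopCocycle_eq (ε : S.TwistCocycle) (γ ρ : S.loopGroup) {ξ η : ℝ → 𝔥}
    (h : S.IsLift γ ξ) (k : S.IsLift ρ η) :
    loopCocycle ε γ ρ
      = ε.toFun (disp γ) (disp ρ) * Circle.exp (2 * Real.pi * pathForm ξ η) := by
  rw [loopCocycle, exp_pathForm_eq h (isLift_lift γ) k (isLift_lift ρ)]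

lemma loopCocycle_assoc (ε : S.TwistCocycle) (γ ρ σ : S.loopGroup) :
    loopCocycle ε γ ρ * loopCocycle ε (γ + ρ) σ
      = loopCocycle ε ρ σ * loopCocycle ε γ (ρ + σ) := by
  have aux : ∀ a b x y z : Circle, a * b * (x * (y * z)) = a * z * (b * (x * y)) := by
    intro a b x y z; simp only [mul_comm, mul_left_comm, mul_assoc]
  have h := isLift_lift γ
  have k := isLift_lift ρ
  have m := isLift_lift σ
  rw [loopCocycle_eq ε (γ + ρ) σ (h.add k) m, loopCocycle_eq ε γ (ρ + σ) h (k.add m),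
    pathForm_add_left h.smooth k.smooth m.smooth, pathForm_add_right h.smooth k.smooth m.smooth,
    loopCocycle, loopCocycle, map_add, map_add, mul_add, mul_add, Circle.exp_add, Circle.exp_add]
  have := ε.assoc (disp γ) (disp ρ) (disp σ)
  rw [mul_mul_mul_comm, this]
  exact aux _ _ _ _ _

lemma loopCocycle_zero_left (ε : S.TwistCocycle) (γ : S.loopGroup) :
    loopCocycle ε 0 γ = 1 := by
  rw [loopCocycle_eq ε 0 γ IsLift.zero (isLift_lift γ), map_zero, ε.zero_left]
  have : (0 : ℝ → 𝔥) = fun _ => 0 := rfl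
  rw [this, pathForm, loopForm_const_left]
  simp

/-- The central extension `L̃(T_w, H, T_b) = L(T_w, H, T_b) × 𝕋`, with product
`(γ, z)(ρ, w) = (γ + ρ, z w c(γ, ρ))`. -/
@[ext]
structure CentralExtension (ε : S.TwistCocycle) where
  loop : S.loopGroup
  phase : Circle

namespace CentralExtension

variable {ε : S.TwistCocycle}

instance : Mul (CentralExtension ε) :=
  ⟨fun g h => ⟨g.loop + h.loop, g.phase * h.phase * loopCocycle ε g.loop h.loop⟩⟩
instance : One (CentralExtension ε) := ⟨⟨0, 1⟩⟩
instance : Inv (CentralExtension ε) :=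
  ⟨fun g => ⟨-g.loop, g.phase⁻¹ * (loopCocycle ε (-g.loop) g.loop)⁻¹⟩⟩

lemma mul_loop (g h : CentralExtension ε) : (g * h).loop = g.loop + h.loop := rfl
lemma mul_phase (g h : CentralExtension ε) :
    (g * h).phase = g.phase * h.phase * loopCocycle ε g.loop h.loop := rfl

instance : Group (CentralExtension ε) := Group.ofLeftAxioms
  (fun g h k => by
    refine CentralExtension.ext (add_assoc _ _ _) ?_
    simp only [mul_phase, mul_loop]
    have := loopCocycle_assoc ε g.loop h.loop k.loop
    calc g.phase * h.phase * loopCocycle ε g.loop h.loop * k.phase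
          * loopCocycle ε (g.loop + h.loop) k.loop
        = g.phase * h.phase * k.phase *
          (loopCocycle ε g.loop h.loop * loopCocycle ε (g.loop + h.loop) k.loop) := by
          simp only [mul_comm, mul_left_comm, mul_assoc]
      _ = _ := by
          rw [this]; simp only [mul_comm, mul_left_comm, mul_assoc])
  (fun g => CentralExtension.ext (zero_add _) (by
    change 1 * g.phase * loopCocycle ε 0 g.loop = g.phase
    rw [loopCocycle_zero_left, one_mul, mul_one]))
  (fun g => CentralExtension.ext (neg_add_cancel _) (by
    change g.phase⁻¹ * (loopCocycle ε (-g.loop) g.loop)⁻¹ * g.phase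
      * loopCocycle ε (-g.loop) g.loop = 1
    rw [mul_right_comm _ _ g.phase, inv_mul_cancel, one_mul, inv_mul_cancel]))

variable (ε)

/-- The subgroup of all `(γ, z)` with `Δ'(Pth γ) = 0`. -/
def degreeZero : Subgroup (CentralExtension ε) where
  carrier := {g | disp g.loop = 0}
  one_mem' := map_zero disp
  mul_mem' {g h} hg hh := by
    change disp (g.loop + h.loop) = 0
    rw [map_add, hg, hh, add_zero]
  inv_mem' {g} hg := by
    change disp (-g.loop) = 0
    rw [map_neg, hg, neg_zero]

end CentralExtension

/-! ### The representations `W_{χ,l}` -/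

/-- The average of a lift over the circle. -/
def average (ξ : ℝ → 𝔥) : 𝔥 := ∫ t in (0 : ℝ)..1, ξ t

lemma IsLift.sub_average_mem {γ : S.loopGroup} (hγ : disp γ = 0) {ξ : ℝ → 𝔥}
    (h : S.IsLift γ ξ) : (fun t => ξ t - average ξ) ∈ MeanZeroLoops 𝔥 := by
  have e := disp_eq γ h
  rw [hγ] at e
  refine ⟨h.smooth.sub contDiff_const, fun t => ?_, ?_⟩
  · change ξ (t + 1) - _ = ξ t - _
    rw [h.quasi t, ← e]; simp
  · rw [intervalIntegral.integral_sub (h.smooth.continuous.intervalIntegrable _ _) (by simp)]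
    simp [average]

variable (S)
/-- `(Λ_w ∩ Λ_b)/Γ` -/
def interQuot : AddSubgroup S.H := S.inter.map (QuotientAddGroup.mk' S.Γ)
variable {S}

/-- The element `γ_m(q) - Pth(γ)(1)` of `H`. -/
def monodromy (γ : S.loopGroup) : S.H := (γ : S.Triple).atQ - QuotientAddGroup.mk (lift γ 1)

lemma monodromy_eq (γ : S.loopGroup) {ξ : ℝ → 𝔥} (h : S.IsLift γ ξ) :
    monodromy γ = (γ : S.Triple).atQ - QuotientAddGroup.mk (ξ 1) := by
  obtain ⟨v, hv, e⟩ := h.unique (isLift_lift γ)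
  unfold monodromy
  congr 1
  rw [QuotientAddGroup.eq, e]
  simpa using hv

lemma monodromy_mem {γ : S.loopGroup} (hγ : disp γ = 0) : monodromy γ ∈ S.interQuot := by
  obtain ⟨x, hx⟩ := QuotientAddGroup.mk_surjective (γ : S.Triple).atQ
  have h := isLift_lift γ
  have e : lift γ 1 - lift γ 0 = 0 := by
    rw [← disp_eq γ h, hγ]; rfl
  refine ⟨x - lift γ 1, ⟨?_, ?_⟩, ?_⟩
  · have := (h.white 1 (by norm_num)).trans γ.2.white_q
    rw [← hx] at this
    have := QuotientAddGroup.eq.1 this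
    change S.πw (x - lift γ 1) ∈ S.Λw
    rw [map_sub, ← neg_add_eq_sub]
    exact this
  · have := (h.black 0 (by norm_num)).trans γ.2.black_q
    rw [← hx] at this
    have := QuotientAddGroup.eq.1 this
    change S.πb (x - lift γ 1) ∈ S.Λb
    rw [sub_eq_zero.1 e, map_sub, ← neg_add_eq_sub]
    exact this
  · rw [monodromy, ← hx]; rfl

variable {ε : S.TwistCocycle}

/-- The mean-zero loop `ξ - avg ξ`. -/
def oscillation (g : CentralExtension.degreeZero ε) : MeanZeroLoops 𝔥 :=
  ⟨fun t => lift g.1.loop t - average (lift g.1.loop),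
    (isLift_lift g.1.loop).sub_average_mem g.2⟩

/-- The average of `Pth γ` in `H`, i.e. the image of `avg ξ`. -/
def averageH (g : CentralExtension.degreeZero ε) : S.H :=
  QuotientAddGroup.mk (average (lift g.1.loop))

/-- The element `γ_m(q) - Pth(γ)(1)` of `(Λw ∩ Λb)/Γ`. -/
def monodromyN (g : CentralExtension.degreeZero ε) : S.interQuot :=
  ⟨monodromy g.1.loop, monodromy_mem g.2⟩

lemma monodromyN_mul (g h : CentralExtension.degreeZero ε) :
    monodromyN (g * h) = monodromyN g + monodromyN h := by
  ext
  change monodromy (g.1.loop + h.1.loop) = monodromy g.1.loop + monodromy h.1.loop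
  rw [monodromy_eq (g.1.loop + h.1.loop) ((isLift_lift g.1.loop).add (isLift_lift h.1.loop))]
  unfold monodromy
  change (g.1.loop : S.Triple).atQ + (h.1.loop : S.Triple).atQ
    - (QuotientAddGroup.mk (lift g.1.loop 1) + QuotientAddGroup.mk (lift h.1.loop 1)) = _
  abel

lemma exists_average_mul (g h : CentralExtension.degreeZero ε) :
    ∃ v ∈ S.Γ, (∀ t, lift (g * h).1.loop t = lift g.1.loop t + lift h.1.loop t + v) ∧
      average (lift (g * h).1.loop) = average (lift g.1.loop) + average (lift h.1.loop) + v := by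
  have hg := isLift_lift g.1.loop
  have hh := isLift_lift h.1.loop
  obtain ⟨v, hv, e⟩ := (hg.add hh).unique (isLift_lift (g.1.loop + h.1.loop))
  refine ⟨v, hv, e, ?_⟩
  have : lift (g * h).1.loop = fun t => (lift g.1.loop t + lift h.1.loop t) + v := funext e
  rw [this]
  have c1 := hg.smooth.continuous
  have c2 := hh.smooth.continuous
  unfold average
  rw [intervalIntegral.integral_add (by apply Continuous.intervalIntegrable; fun_prop)
    (by simp), intervalIntegral.integral_add (by apply Continuous.intervalIntegrable; fun_prop)
    (by apply Continuous.intervalIntegrable; fun_prop)]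
  simp

lemma averageH_mul (g h : CentralExtension.degreeZero ε) :
    averageH (g * h) = averageH g + averageH h := by
  obtain ⟨v, hv, -, e⟩ := exists_average_mul g h
  unfold averageH
  rw [e, ← QuotientAddGroup.mk_add, QuotientAddGroup.eq]
  have : -(average (lift g.1.loop) + average (lift h.1.loop) + v)
      + (average (lift g.1.loop) + average (lift h.1.loop)) = -v := by abel
  rw [this]
  exact neg_mem hv

lemma oscillation_mul (g h : CentralExtension.degreeZero ε) :
    oscillation (g * h) = oscillation g + oscillation h := by
  obtain ⟨v, -, e, e'⟩ := exists_average_mul g h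
  ext t
  change lift (g * h).1.loop t - average (lift (g * h).1.loop)
    = lift g.1.loop t - average (lift g.1.loop) + (lift h.1.loop t - average (lift h.1.loop))
  rw [e, e']
  abel

lemma phase_mul (g h : CentralExtension.degreeZero ε) :
    (g * h).1.phase = g.1.phase * h.1.phase
      * Circle.exp (2 * Real.pi * loopForm (oscillation g : ℝ → 𝔥) (oscillation h)) := by
  change g.1.phase * h.1.phase * loopCocycle ε g.1.loop h.1.loop = _
  have hg := isLift_lift g.1.loop
  have hh := isLift_lift h.1.loop
  have d1 : disp g.1.loop = 0 := g.2
  have d2 : disp h.1.loop = 0 := h.2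
  have p1 : lift g.1.loop 1 - lift g.1.loop 0 = 0 := by
    rw [← disp_eq _ hg, d1]; rfl
  rw [loopCocycle, d1, d2, ε.zero_left, one_mul, pathForm, p1, inner_zero_left, mul_zero,
    add_zero]
  have f1 : (oscillation g : ℝ → 𝔥) = lift g.1.loop + fun _ => -average (lift g.1.loop) := by
    ext t; simp [oscillation, sub_eq_add_neg]
  have f2 : (oscillation h : ℝ → 𝔥) = lift h.1.loop + fun _ => -average (lift h.1.loop) := by
    ext t; simp [oscillation, sub_eq_add_neg]
  have k1 : ContDiff ℝ ∞ (lift h.1.loop + fun _ => -average (lift h.1.loop)) :=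
    hh.smooth.add contDiff_const
  rw [f1, f2, loopForm_add_left hg.smooth contDiff_const k1,
    loopForm_const_left, add_zero, loopForm_add_right hg.smooth hh.smooth contDiff_const,
    loopForm_const_right hg.smooth, p1, inner_zero_left, mul_zero, add_zero]

variable (ε)

/-- The representation `W_{χ,l}`, acting on `ℂ_χ ⊗ ℂ_l ⊗ (Fock space)`, identified with Fock space:
`(γ, z) ↦ χ(γ_m(q) - Pth(γ)(1)) l(avg γ) W(ξ - avg ξ, z)`. -/
def weylRep (χ : AddChar S.interQuot Circle) (l : AddChar S.H Circle) :
    CentralExtension.degreeZero ε →* (FockSpace 𝔥 ≃ₗᵢ[ℂ] FockSpace 𝔥) :=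
  MonoidHom.mk' (fun g => weyl (oscillation g) (χ (monodromyN g) * l (averageH g) * g.1.phase))
  (by
    intro g h
    have aux : ∀ a b c d e f x : Circle,
        (a * b) * (c * d) * (e * f * x) = (a * c * e) * (b * d * f) * x := by
      intro a b c d e f x; simp only [mul_comm, mul_left_comm, mul_assoc]
    rw [weyl_mul, oscillation_mul, monodromyN_mul, averageH_mul, phase_mul,
      AddChar.map_add_eq_mul, AddChar.map_add_eq_mul, aux])

end LatticeSpan

/-! ### Induced unitary representations -/

section Induction

variable {G : Type*} [Group G] {K : Subgroup G} {𝓚 : Type*} [NormedAddCommGroup 𝓚]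
  [InnerProductSpace ℂ 𝓚]

/-- Functions `f : G → 𝓚` with `f(xk) = Q(k)⁻¹ f(x)` for `k ∈ K` and `∑_{xK ∈ G/K} ‖f(x)‖² < ∞`. -/
def inducedFunctions (Q : K →* (𝓚 ≃ₗᵢ[ℂ] 𝓚)) : Submodule ℂ (G → 𝓚) where
  carrier := {f | (∀ (x : G) (k : K), f (x * k) = Q k⁻¹ (f x)) ∧
    Memℓp (fun σ : G ⧸ K => f σ.out) 2}
  zero_mem' := ⟨fun x k => by simp, zero_memℓp⟩
  add_mem' := by
    rintro f g ⟨h1, h2⟩ ⟨k1, k2⟩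
    exact ⟨fun x k => by simp [h1, k1], h2.add k2⟩
  smul_mem' := by
    rintro c f ⟨h1, h2⟩
    exact ⟨fun x k => by simp [h1], h2.const_smul c⟩

/-- The Hilbert space of the representation of `G` induced by the unitary representation `Q` of the
subgroup `K`: the completed direct sum over the cosets `σ ∈ G/K` of the spaces `σ ×_K 𝓚`. The class of
`(x, v)` in `xK ×_K 𝓚` is the function supported on `xK` with `xk ↦ Q(k)⁻¹ v`. -/
def IndSpace (Q : K →* (𝓚 ≃ₗᵢ[ℂ] 𝓚)) : Type _ := inducedFunctions Q

namespace IndSpace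

variable {Q : K →* (𝓚 ≃ₗᵢ[ℂ] 𝓚)}

instance : AddCommGroup (IndSpace Q) := inferInstanceAs (AddCommGroup (inducedFunctions Q))
instance : Module ℂ (IndSpace Q) := inferInstanceAs (Module ℂ (inducedFunctions Q))

/-- Values of the function. -/
def eval (f : IndSpace Q) (x : G) : 𝓚 := f.1 x

lemma eval_ext {f g : IndSpace Q} (h : ∀ x, f.eval x = g.eval x) : f = g :=
  Subtype.ext (funext h)

lemma norm_eval_mul (f : IndSpace Q) (x : G) (k : K) : ‖f.eval (x * k)‖ = ‖f.eval x‖ := by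
  change ‖f.1 (x * k)‖ = ‖f.1 x‖
  rw [f.2.1 x k, LinearIsometryEquiv.norm_map]

lemma norm_eval_out (f : IndSpace Q) (x : G) :
    ‖f.eval (Quotient.out (x : G ⧸ K))‖ = ‖f.eval x‖ := by
  obtain ⟨k, hk⟩ := QuotientGroup.mk_out_eq_mul K x
  rw [hk, norm_eval_mul]

/-- Values on representatives of the cosets. -/
def toLp : IndSpace Q →ₗ[ℂ] lp (fun _ : G ⧸ K => 𝓚) 2 where
  toFun f := ⟨fun σ => f.eval σ.out, f.2.2⟩
  map_add' _ _ := rfl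
  map_smul' _ _ := rfl

lemma toLp_injective : Function.Injective (toLp (Q := Q)) := by
  rw [← LinearMap.ker_eq_bot, LinearMap.ker_eq_bot']
  intro f hf
  refine eval_ext fun x => ?_
  have : f.eval (Quotient.out (x : G ⧸ K)) = 0 :=
    congrFun (congrArg (fun y : lp (fun _ : G ⧸ K => 𝓚) 2 => (y : G ⧸ K → 𝓚)) hf) _
  have h := norm_eval_out f x
  rw [this, norm_zero] at h
  exact norm_eq_zero.1 h.symm

instance : NormedAddCommGroup (IndSpace Q) :=
  NormedAddCommGroup.induced (IndSpace Q) (lp (fun _ : G ⧸ K => 𝓚) 2) (toLp (Q := Q))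
    toLp_injective

lemma norm_toLp (f : IndSpace Q) : ‖toLp f‖ = ‖f‖ := rfl

/-- The inner product is `∑_{xK ∈ G/K} ⟨f(x), g(x)⟩`. -/
instance : InnerProductSpace ℂ (IndSpace Q) where
  norm_smul_le c f := by
    rw [← norm_toLp, ← norm_toLp, map_smul]
    exact norm_smul_le c _
  inner f g := inner ℂ (toLp f) (toLp g)
  norm_sq_eq_re_inner f := by
    rw [← norm_toLp]
    exact InnerProductSpace.norm_sq_eq_re_inner _
  conj_inner_symm f g := inner_conj_symm _ _
  add_left f g k := by rw [map_add, inner_add_left]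
  smul_left f g c := by rw [map_smul, inner_smul_left]

/-- Left translation `(g f)(x) = f(g⁻¹ x)`. -/
def shift (g : G) (f : IndSpace Q) : IndSpace Q :=
  ⟨fun x => f.eval (g⁻¹ * x), fun x k => by
    change f.1 (g⁻¹ * (x * k)) = _
    rw [← mul_assoc, f.2.1]; rfl, by
    have h2 : (0 : ℝ) < (2 : ENNReal).toReal := by simp
    rw [memℓp_gen_iff h2]
    have := (memℓp_gen_iff h2).1 f.2.2
    refine ((MulAction.toPerm g⁻¹ : Equiv.Perm (G ⧸ K)).summable_iff.2 this).congr fun σ => ?_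
    have e : ((g⁻¹ * σ.out : G) : G ⧸ K) = g⁻¹ • σ := by
      conv_rhs => rw [← QuotientGroup.out_eq' σ]
      rfl
    have := norm_eval_out f (g⁻¹ * σ.out)
    rw [e] at this
    rw [← this]; rfl⟩

lemma norm_shift (g : G) (f : IndSpace Q) : ‖shift g f‖ = ‖f‖ := by
  have h2 : (0 : ℝ) < (2 : ENNReal).toReal := by simp
  rw [← norm_toLp, ← norm_toLp, lp.norm_eq_tsum_rpow h2, lp.norm_eq_tsum_rpow h2]
  congr 1
  conv_rhs => rw [← (MulAction.toPerm g⁻¹ : Equiv.Perm (G ⧸ K)).tsum_eq]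
  refine tsum_congr fun σ => ?_
  have e : ((g⁻¹ * σ.out : G) : G ⧸ K) = g⁻¹ • σ := by
    conv_rhs => rw [← QuotientGroup.out_eq' σ]
    rfl
  have := norm_eval_out f (g⁻¹ * σ.out)
  rw [e] at this
  change ‖f.eval (g⁻¹ * σ.out)‖ ^ _ = ‖f.eval (Quotient.out (g⁻¹ • σ))‖ ^ _
  rw [this]

lemma shift_shift (g h : G) (f : IndSpace Q) :
    shift g (shift h f) = shift (g * h) f := by
  refine eval_ext fun x => ?_
  change f.eval (h⁻¹ * (g⁻¹ * x)) = f.eval ((g * h)⁻¹ * x)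
  rw [mul_inv_rev, mul_assoc]

lemma shift_one (f : IndSpace Q) : shift 1 f = f := by
  refine eval_ext fun x => ?_
  change f.eval (1⁻¹ * x) = f.eval x
  rw [inv_one, one_mul]

end IndSpace

open IndSpace in
/-- The unitary representation of `G` induced by `Q`, acting by left translation; it sends the class
of `(x, v)` to the class of `(gx, v)`. -/
def inducedRep (Q : K →* (𝓚 ≃ₗᵢ[ℂ] 𝓚)) : G →* (IndSpace Q ≃ₗᵢ[ℂ] IndSpace Q) :=
  MonoidHom.mk' (fun g =>
    { toFun := shift g
      invFun := shift g⁻¹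
      map_add' := fun _ _ => rfl
      map_smul' := fun _ _ => rfl
      left_inv := fun f => by rw [shift_shift, inv_mul_cancel, shift_one]
      right_inv := fun f => by rw [shift_shift, mul_inv_cancel, shift_one]
      norm_map' := norm_shift g })
    (fun g h => LinearIsometryEquiv.ext fun f => (shift_shift g h f).symm)

end Induction

/-- There is a unitary intertwining operator. -/
def UnitarilyIsomorphic {G V W : Type*} [Group G] [NormedAddCommGroup V] [InnerProductSpace ℂ V]
    [NormedAddCommGroup W] [InnerProductSpace ℂ W] (P : G →* (V ≃ₗᵢ[ℂ] V))
    (Q : G →* (W ≃ₗᵢ[ℂ] W)) : Prop :=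
  ∃ U : V ≃ₗᵢ[ℂ] W, ∀ g v, U (P g v) = Q g (U v)

/-- There is a bounded, boundedly invertible intertwining operator. -/
def BoundedlyIsomorphic {G V W : Type*} [Group G] [NormedAddCommGroup V] [InnerProductSpace ℂ V]
    [NormedAddCommGroup W] [InnerProductSpace ℂ W] (P : G →* (V ≃ₗᵢ[ℂ] V))
    (Q : G →* (W ≃ₗᵢ[ℂ] W)) : Prop :=
  ∃ U : V ≃L[ℂ] W, ∀ g v, U (P g v) = Q g (U v)


namespace LatticeSpan

/-- The representation `Ind W_{χ,l}` of `L̃(T_w, H, T_b)`. -/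
def indWeylRep {S : LatticeSpan 𝔥 𝔱w 𝔱b} (ε : S.TwistCocycle) (χ : AddChar S.interQuot Circle)
    (l : AddChar S.H Circle) :
    CentralExtension ε →* (IndSpace (weylRep ε χ l) ≃ₗᵢ[ℂ] IndSpace (weylRep ε χ l)) :=
  inducedRep (weylRep ε χ l)

end LatticeSpan

end TorusLoop

end

/-! Mackey theory for the normal subgroup `degreeZero ε`, here called K, which is the kernel of the
displacement. By `shift_eval`, an element k of K acts on the value at x of a function in the induced
space through Q(x⁻¹kx). Restricted to K, the induced representation is thus the sum of the
conjugates of Q, one for each coset, and the problem is to see how conjugation changes W_{χ,l}.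

The loop group is abelian, so conjugating k by g only multiplies the phase of k by a commutator
(`conjBy_eq`). Since ε is normalised and k has displacement zero, ε drops out of it, leaving the
antisymmetrisation of `pathForm`. For g with lift tλ an integration by parts evaluates this to
e^{-2πi⟨λ, avg⟩}, where avg is the average of the lift of k. So conjugation by g turns W_{χ,l} into
W_{χ,l-λ}, and right translation by g is a unitary intertwiner of the induced representations. Every
λ in Λw - Λb is the displacement of such a g (`exists_linear_loop`).

For the converse, no decomposition into irreducibles is needed: it suffices to test on elements of K
acting by scalars. Loops with a constant lift x and arbitrary monodromy n have zero oscillation, so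
their Weyl operators are scalar; on the fibre over gK the scalar is χ(n) l([x]) e^{-2πi⟨Δ'g, x⟩}
(`weylRep_const`). A bounded intertwiner carries a joint eigenvector in the fibre over the trivial
coset to a nonzero function, and at any point where that function does not vanish the two families
of scalars coincide (`exists_scalar_eq`). Putting x = 0 recovers χ, and n = 0 recovers l up to the
character of a displacement.

Unitary equivalence implies bounded equivalence, so these two arguments prove both equivalences of
the theorem. -/

noncomputable section

namespace TorusLoop

/-! ### Induction from a normal subgroup -/

section Induction

variable {G : Type*} [Group G] {K : Subgroup G} {𝓚 : Type*} [NormedAddCommGroup 𝓚]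
  [InnerProductSpace ℂ 𝓚]

namespace IndSpace

/-! ### Vectors in the fibre over the trivial coset -/

lemma eval_mul {Q : K →* (𝓚 ≃ₗᵢ[ℂ] 𝓚)} (f : IndSpace Q) (x : G) (k : K) :
    f.eval (x * k) = Q k⁻¹ (f.eval x) := f.2.1 x k

/-- The class of `(1, v)`: the function supported on `K` with `k ↦ Q(k)⁻¹ v`. -/
def ofFiber (Q : K →* (𝓚 ≃ₗᵢ[ℂ] 𝓚)) (v : 𝓚) : IndSpace Q :=
  open scoped Classical in
  ⟨fun x => if hx : x ∈ K then Q (⟨x, hx⟩ : K)⁻¹ v else 0, by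
    intro x k
    by_cases hx : x ∈ K
    · have hxk : x * k ∈ K := mul_mem hx k.2
      have e : (⟨x * k, hxk⟩ : K)⁻¹ = k⁻¹ * (⟨x, hx⟩ : K)⁻¹ := by ext; simp
      simp only [hx, hxk, dif_pos, e, map_mul]
      rfl
    · have hxk : x * k ∉ K := fun h => hx ((mul_mem_cancel_right k.2).1 h)
      simp [hx, hxk], by
    have h2 : (0 : ℝ) < (2 : ENNReal).toReal := by simp
    rw [memℓp_gen_iff h2]
    -- Square summability is trivial: only the trivial coset contributes to the sum.
    refine summable_of_hasFiniteSupport ((finite_singleton ((1 : G) : G ⧸ K)).subset fun σ hσ => ?_)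
    by_contra hne
    refine hσ ?_
    have hout : σ.out ∉ K := fun h => hne (by
      rw [mem_singleton_iff, ← QuotientGroup.out_eq' σ]
      exact QuotientGroup.eq.2 (by simpa using h))
    simp [hout]⟩

lemma ofFiber_eval_of_mem (Q : K →* (𝓚 ≃ₗᵢ[ℂ] 𝓚)) (v : 𝓚) (k : K) :
    (ofFiber Q v).eval (k : G) = Q k⁻¹ v := dif_pos k.2

lemma ofFiber_eval_of_notMem (Q : K →* (𝓚 ≃ₗᵢ[ℂ] 𝓚)) (v : 𝓚) {x : G} (hx : x ∉ K) :
    (ofFiber Q v).eval x = 0 := dif_neg hx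

/-- For x in K the left translate takes the value Q(x⁻¹k)v = Q(x)⁻¹Q(k)v, and off K both sides
vanish. Eigenvectors of Q thus become eigenvectors of the induced representation. -/
lemma shift_ofFiber {Q : K →* (𝓚 ≃ₗᵢ[ℂ] 𝓚)} {v : 𝓚} {k : K} {c : ℂ} (h : Q k v = c • v) :
    shift (k : G) (ofFiber Q v) = c • ofFiber Q v := by
  refine eval_ext fun x => ?_
  change (ofFiber Q v).eval ((k : G)⁻¹ * x) = c • (ofFiber Q v).eval x
  by_cases hx : x ∈ K
  · have e1 := ofFiber_eval_of_mem Q v (k⁻¹ * ⟨x, hx⟩)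
    have e2 := ofFiber_eval_of_mem Q v ⟨x, hx⟩
    simp only [Subgroup.coe_mul, Subgroup.coe_inv] at e1 e2
    rw [e1, e2, mul_inv_rev, inv_inv, map_mul, ← map_smul, ← h]
    rfl
  · rw [ofFiber_eval_of_notMem _ _ hx, ofFiber_eval_of_notMem _ _ fun h => hx
      ((mul_mem_cancel_left (inv_mem k.2)).1 h), smul_zero]

/-! ### The action of a normal subgroup on the fibres, and right translation -/

variable [K.Normal]

/-- The conjugate `g⁻¹ k g` in a normal subgroup. -/
def conjBy (g : G) (k : K) : K :=
  ⟨g⁻¹ * k * g, by simpa using ‹K.Normal›.conj_mem k k.2 g⁻¹⟩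

/-- Normality allows k⁻¹x to be rewritten as x(x⁻¹kx)⁻¹, to which the equivariance of f applies.
Hence K preserves every fibre and acts on the one over xK through a conjugate of Q. -/
lemma shift_eval {Q : K →* (𝓚 ≃ₗᵢ[ℂ] 𝓚)} (f : IndSpace Q) (k : K) (x : G) :
    (shift (k : G) f).eval x = Q (conjBy x k) (f.eval x) := by
  have := eval_mul f x (conjBy x k)⁻¹
  rw [inv_inv] at this
  rw [← this]
  change f.eval ((k : G)⁻¹ * x) = _
  congr 1
  simp [conjBy, mul_assoc]

/-- As K is normal, right multiplication by g permutes the cosets, and the norm of a value depends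
only on its coset. This makes `translate` well defined and isometric. -/
lemma norm_eval_out_mul {Q : K →* (𝓚 ≃ₗᵢ[ℂ] 𝓚)} (f : IndSpace Q) (g : G) (σ : G ⧸ K) :
    ‖f.eval (σ.out * g)‖ = ‖f.eval (Quotient.out (Equiv.mulRight (g : G ⧸ K) σ))‖ := by
  have e : ((σ.out * g : G) : G ⧸ K) = Equiv.mulRight (g : G ⧸ K) σ := by
    conv_rhs => rw [← QuotientGroup.out_eq' σ]
    rfl
  rw [← norm_eval_out f (σ.out * g), e]

/-- Right translation by `g`, from the representation induced by `Q` to the one induced by the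
conjugate `k ↦ Q(g⁻¹ k g)`. -/
def translate {Q Q' : K →* (𝓚 ≃ₗᵢ[ℂ] 𝓚)} (g : G) (h : ∀ k, Q' k = Q (conjBy g k))
    (f : IndSpace Q) : IndSpace Q' :=
  ⟨fun x => f.eval (x * g), fun x k => by
    rw [h]
    -- The equivariance of the translate comes from xkg = xg(g⁻¹kg).
    have := eval_mul f (x * g) (conjBy g k)
    have e : (conjBy g k)⁻¹ = conjBy g k⁻¹ := by ext; simp [conjBy, mul_assoc]
    rw [e] at this
    rw [← this]
    simp [conjBy, mul_assoc], by
    have h2 : (0 : ℝ) < (2 : ENNReal).toReal := by simp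
    rw [memℓp_gen_iff h2]
    refine ((Equiv.mulRight (g : G ⧸ K)).summable_iff.2
      ((memℓp_gen_iff h2).1 f.2.2)).congr fun σ => ?_
    exact congrArg (· ^ (2 : ENNReal).toReal) (norm_eval_out_mul f g σ).symm⟩

lemma norm_translate {Q Q' : K →* (𝓚 ≃ₗᵢ[ℂ] 𝓚)} (g : G) (h : ∀ k, Q' k = Q (conjBy g k))
    (f : IndSpace Q) : ‖translate g h f‖ = ‖f‖ := by
  have h2 : (0 : ℝ) < (2 : ENNReal).toReal := by simp
  rw [← norm_toLp, ← norm_toLp, lp.norm_eq_tsum_rpow h2, lp.norm_eq_tsum_rpow h2]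
  congr 1
  conv_rhs => rw [← (Equiv.mulRight (g : G ⧸ K)).tsum_eq]
  exact tsum_congr fun σ => congrArg (· ^ (2 : ENNReal).toReal) (norm_eval_out_mul f g σ)

end IndSpace

open IndSpace

variable [K.Normal]

/-- Conjugate representations of a normal subgroup induce isomorphic representations. -/
lemma unitarilyIsomorphic_inducedRep {Q Q' : K →* (𝓚 ≃ₗᵢ[ℂ] 𝓚)} (g : G)
    (h : ∀ k, Q' k = Q (conjBy g k)) :
    UnitarilyIsomorphic (inducedRep Q) (inducedRep Q') := by
  -- The relation between Q and Q' is symmetric under exchanging g and g⁻¹, so translation by g⁻¹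
  -- provides the inverse.
  have h' : ∀ k, Q k = Q' (conjBy g⁻¹ k) := fun k => by
    rw [h]
    congr 1
    ext
    simp [conjBy, mul_assoc]
  refine ⟨{ toFun := translate g h
            invFun := translate g⁻¹ h'
            map_add' := fun _ _ => rfl
            map_smul' := fun _ _ => rfl
            left_inv := fun f => eval_ext fun x => ?_
            right_inv := fun f => eval_ext fun x => ?_
            norm_map' := norm_translate g h }, fun x f => eval_ext fun y => ?_⟩
  · change f.eval (x * g⁻¹ * g) = f.eval x
    rw [inv_mul_cancel_right]
  · change f.eval (x * g * g⁻¹) = f.eval x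
    rw [mul_inv_cancel_right]
  -- Left and right translations commute.
  · change f.eval (x⁻¹ * (y * g)) = f.eval (x⁻¹ * y * g)
    rw [mul_assoc]

/-- If two induced representations are isomorphic, the scalars by which elements of the normal
subgroup act on the fibre of the first one over the trivial coset occur on some fibre of the second. -/
lemma exists_scalar_eq {Q Q' : K →* (𝓚 ≃ₗᵢ[ℂ] 𝓚)} [Nontrivial 𝓚]
    (hU : BoundedlyIsomorphic (inducedRep Q) (inducedRep Q')) {ι : Type*} {k : ι → K}
    {a : ι → ℂ} {b : G → ι → ℂ} (ha : ∀ i v, Q (k i) v = a i • v)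
    (hb : ∀ x i v, Q' (conjBy x (k i)) v = b x i • v) : ∃ x, ∀ i, a i = b x i := by
  obtain ⟨U, hU⟩ := hU
  obtain ⟨v, hv⟩ := exists_ne (0 : 𝓚)
  have hf : ofFiber Q v ≠ 0 := fun h => hv (by
    have := ofFiber_eval_of_mem Q v 1
    rw [h, inv_one, map_one] at this
    exact this.symm)
  obtain ⟨x, hx⟩ : ∃ x, (U (ofFiber Q v)).eval x ≠ 0 := by
    by_contra! h
    exact hf (U.map_eq_zero_iff.1 (eval_ext h))
  refine ⟨x, fun i => ?_⟩
  -- One eigenvalue equation, read on both sides of U: k i scales the source vector by a i, and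
  -- scales the value of its image at x by b x i.
  have h1 : U (shift (k i : G) (ofFiber Q v)) = shift (k i : G) (U (ofFiber Q v)) := hU _ _
  rw [shift_ofFiber (ha i v), map_smul] at h1
  have h2 := congrArg (fun f => IndSpace.eval f x) h1
  simp only [shift_eval, hb] at h2
  exact smul_left_injective ℂ hx h2

end Induction

lemma UnitarilyIsomorphic.boundedlyIsomorphic {G V W : Type*} [Group G] [NormedAddCommGroup V]
    [InnerProductSpace ℂ V] [NormedAddCommGroup W] [InnerProductSpace ℂ W]
    {P : G →* (V ≃ₗᵢ[ℂ] V)} {Q : G →* (W ≃ₗᵢ[ℂ] W)} (h : UnitarilyIsomorphic P Q) :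
    BoundedlyIsomorphic P Q := by
  obtain ⟨U, hU⟩ := h
  exact ⟨U.toContinuousLinearEquiv, hU⟩

/-! ### Weyl operators of the zero loop -/

section Weyl

variable {E : Type*} [NormedAddCommGroup E] [InnerProductSpace ℝ E] [FiniteDimensional ℝ E]

/-- The vacuum e^0 has nonzero norm, its square being an exponential. -/
instance : Nontrivial (FockSpace E) :=
  ⟨coherent 0, 0, fun h => by
    have := inner_coherent (E := E) 0 0
    rw [h, inner_zero_left] at this
    exact Complex.exp_ne_zero _ this.symm⟩

/-- The exponent of the Weyl factor vanishes at the zero loop, so both operators agree on the total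
set of coherent vectors. This is what makes loops with constant lifts act by scalars. -/
lemma weyl_zero (z : Circle) (v : FockSpace E) : weyl 0 z v = (z : ℂ) • v := by
  have h0 : ∀ κ : MeanZeroLoops E, weylFactor 0 κ = 1 := fun κ => by
    have e : ∀ κ : MeanZeroLoops E,
        loopHermitian (κ : ℝ → E) ((0 : MeanZeroLoops E) : ℝ → E) = 0 := fun κ => by
      simpa using loopHermitian_add_right (0 : MeanZeroLoops E).2 (0 : MeanZeroLoops E).2 κ.2
    simp only [weylFactor, e]
    simp
  have := isometry_ext denseRange_coherent (S := weylIsometry (0 : MeanZeroLoops E) z)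
    (T := ⟨(z : ℂ) • LinearMap.id, fun x => by simp [norm_smul, Circle.norm_coe]⟩) fun κ => by
      rw [weylIsometry_coherent, h0, mul_one, add_zero]
      rfl
  exact congrArg (fun T : FockSpace E →ₗᵢ[ℂ] FockSpace E => T v) this

end Weyl

variable {𝔥 𝔱w 𝔱b : Type*} [NormedAddCommGroup 𝔥] [InnerProductSpace ℝ 𝔥] [FiniteDimensional ℝ 𝔥]
  [NormedAddCommGroup 𝔱w] [InnerProductSpace ℝ 𝔱w] [FiniteDimensional ℝ 𝔱w]
  [NormedAddCommGroup 𝔱b] [InnerProductSpace ℝ 𝔱b] [FiniteDimensional ℝ 𝔱b]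

/-! ### Integration by parts for the form S -/

/-- Integrate the derivative of ⟨ξ, η⟩. For paths that do not close up, S is antisymmetric only up
to this boundary term. -/
lemma loopForm_add_loopForm_swap {ξ η : ℝ → 𝔥} (h : ContDiff ℝ ∞ ξ) (k : ContDiff ℝ ∞ η) :
    loopForm ξ η + loopForm η ξ = (1 / 2) * (⟪ξ 1, η 1⟫ - ⟪ξ 0, η 0⟫) := by
  have c1 := h.continuous_deriv (by simp)
  have c2 := k.continuous_deriv (by simp)
  have c3 := h.continuous
  have c4 := k.continuous
  have hd : ∀ t, HasDerivAt (fun t => ⟪ξ t, η t⟫) (⟪ξ t, deriv η t⟫ + ⟪deriv ξ t, η t⟫) t :=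
    fun t => ((h.differentiable (by simp)) t).hasDerivAt.inner ℝ
      ((k.differentiable (by simp)) t).hasDerivAt
  have := intervalIntegral.integral_eq_sub_of_hasDerivAt (a := 0) (b := 1) (fun t _ => hd t)
    (by apply Continuous.intervalIntegrable; fun_prop)
  rw [← this, intervalIntegral.integral_add (by apply Continuous.intervalIntegrable; fun_prop)
    (by apply Continuous.intervalIntegrable; fun_prop), loopForm, loopForm]
  simp_rw [real_inner_comm (deriv η _)]
  ring

/-- The derivative of t • v is the constant v, so pairing with a linear path extracts the average of
η; this is how the average enters the conjugation formula. -/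
lemma loopForm_smul_const (v : 𝔥) {η : ℝ → 𝔥} (k : Continuous η) :
    loopForm (fun t => t • v) η = (1 / 2) * ⟪v, LatticeSpan.average η⟫ := by
  have hd : deriv (fun t : ℝ => t • v) = fun _ => v := by
    ext t
    simpa using ((hasDerivAt_id t).smul_const v).deriv
  have := (innerSL ℝ v).intervalIntegral_comp_comm (μ := volume) (a := 0) (b := 1)
    (k.intervalIntegrable 0 1)
  simp only [innerSL_apply_apply] at this
  rw [loopForm, hd, LatticeSpan.average, ← this]

namespace LatticeSpan

/-! ### Loops with a prescribed lift -/

section Loops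

variable {S : LatticeSpan 𝔥 𝔱w 𝔱b}

/-- Transporting the one-sided derivatives of both arcs back to 𝔥 gives the derivatives of the
single smooth function ξ, so for loops built from a global lift the jets at p match automatically.
-/
lemma iteratedDerivWithin_isometry {V W : Type*} [NormedAddCommGroup V] [NormedSpace ℝ V]
    [NormedAddCommGroup W] [NormedSpace ℝ W] (e : V ≃ₗᵢ[ℝ] W) {ξ : ℝ → V} (h : ContDiff ℝ ∞ ξ)
    {s : Set ℝ} (hs : UniqueDiffOn ℝ s) {t : ℝ} (ht : t ∈ s) (k : ℕ) :
    e.symm (iteratedDerivWithin k (fun t => e (ξ t)) s t) = iteratedDeriv k ξ t := by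
  have := e.toContinuousLinearEquiv.iteratedFDerivWithin_comp_left ξ hs ht k
  have e1 : iteratedDerivWithin k (fun t => e (ξ t)) s t = e (iteratedDerivWithin k ξ s t) :=
    congrArg (fun T => T fun _ => 1) this
  rw [e1, LinearIsometryEquiv.symm_apply_apply]
  exact iteratedDerivWithin_eq_iteratedDeriv hs (contDiff_infty.1 h k).contDiffAt ht

/-- ξ(t + 1) and ξ(t) differ by a constant, which is killed by one differentiation. This supplies
the matching of jets at q. -/
lemma iteratedDeriv_one_eq_zero {ξ : ℝ → 𝔥} (hq : ∀ t, ξ (t + 1) = ξ t + (ξ 1 - ξ 0)) {k : ℕ}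
    (hk : 1 ≤ k) : iteratedDeriv k ξ 1 = iteratedDeriv k ξ 0 := by
  have h1 : iteratedDeriv k (fun t => ξ (t + 1)) 0 = iteratedDeriv k ξ 1 := by
    rw [iteratedDeriv_comp_add_const]; simp
  rw [← h1]
  obtain ⟨k, rfl⟩ := Nat.exists_eq_add_of_le' hk
  rw [iteratedDeriv_succ', iteratedDeriv_succ']
  congr 1
  ext t
  simp_rw [hq, deriv_add_const]

/-- The loop with lift `ξ` and the value `[y]` at `q`. -/
lemma exists_loop {ξ : ℝ → 𝔥} (h : ContDiff ℝ ∞ ξ) (hq : ∀ t, ξ (t + 1) = ξ t + (ξ 1 - ξ 0))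
    {y : 𝔥} (hw : ξ 1 - y ∈ S.latW) (hb : ξ 0 - y ∈ S.latB) :
    ∃ γ : S.loopGroup, S.IsLift γ ξ ∧ (γ : S.Triple).atQ = QuotientAddGroup.mk y := by
  let γ : S.Triple := (fun t => QuotientAddGroup.mk (S.πw (ξ t)),
    (QuotientAddGroup.mk (ξ (1 / 2)), QuotientAddGroup.mk y),
    fun t => QuotientAddGroup.mk (S.πb (ξ t)))
  have hγ : S.IsBicoloured γ :=
    { white_p := rfl
      white_q := by
        change (QuotientAddGroup.mk (S.πw (ξ 1)) : S.Tw) = QuotientAddGroup.mk (S.πw y)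
        rw [eq_comm, QuotientAddGroup.eq, neg_add_eq_sub, ← map_sub]
        exact hw
      black_p := rfl
      black_q := by
        change (QuotientAddGroup.mk (S.πb (ξ 0)) : S.Tb) = QuotientAddGroup.mk (S.πb y)
        rw [eq_comm, QuotientAddGroup.eq, neg_add_eq_sub, ← map_sub]
        exact hb
      smooth := ⟨fun t => S.πw (ξ t), fun t => S.πb (ξ t), (S.πw.contDiff.comp h).contDiffOn,
        (S.πb.contDiff.comp h).contDiffOn, fun _ _ => rfl, fun _ _ => rfl,
        fun k _ => by
          rw [iteratedDerivWithin_isometry _ h uniqueDiffOn_w (by norm_num),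
            iteratedDerivWithin_isometry _ h uniqueDiffOn_b (by norm_num)],
        fun k hk => by
          rw [iteratedDerivWithin_isometry _ h uniqueDiffOn_w (by norm_num),
            iteratedDerivWithin_isometry _ h uniqueDiffOn_b (by norm_num),
            iteratedDeriv_one_eq_zero hq hk]⟩ }
  exact ⟨⟨γ, hγ⟩, ⟨h, hq, rfl, fun _ _ => rfl, fun _ _ => rfl⟩, rfl⟩

/-- The displacement homomorphism is onto: the linear path tv has displacement v. -/
lemma exists_linear_loop {v : 𝔥} (hv : v ∈ S.diff) :
    ∃ γ : S.loopGroup, S.IsLift γ fun t => t • v := by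
  obtain ⟨a, ha, b, hb, rfl⟩ := hv
  -- For v = a - b, taking -b as the value at q leaves the discrepancy a on the white side, at t =
  -- 1, and b on the black side, at t = 0.
  obtain ⟨γ, hγ, -⟩ := exists_loop (S := S) (ξ := fun t => t • (a - b)) (y := -b) (by fun_prop)
    (fun t => by simp [add_smul]) (by simpa using ha) (by simpa using hb)
  exact ⟨γ, hγ⟩

/-- The value at q is only constrained modulo Λw ∩ Λb, so it may be moved by a representative of n
without changing the lift. These loops form the supply of scalar operators that detect χ and l. -/
lemma exists_const_loop (x : 𝔥) (n : S.interQuot) :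
    ∃ γ : S.loopGroup, S.IsLift γ (fun _ => x) ∧ disp γ = 0 ∧ monodromy γ = n := by
  obtain ⟨_, y, ⟨hw, hb⟩, rfl⟩ := n
  obtain ⟨γ, hγ, hy⟩ := exists_loop (S := S) (ξ := fun _ => x) (y := x + y) contDiff_const
    (fun t => by simp) (by simpa using hw) (by simpa using hb)
  refine ⟨γ, hγ, ?_, ?_⟩
  · ext
    simp [disp_eq γ hγ]
  · rw [monodromy_eq γ hγ, hy, ← QuotientAddGroup.mk_sub, add_sub_cancel_left]
    rfl

end Loops

/-! ### Conjugation in the central extension -/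

section Conjugation

variable {S : LatticeSpan 𝔥 𝔱w 𝔱b} {ε : S.TwistCocycle}

/-- It is the kernel of a homomorphism to an abelian group. -/
instance : (CentralExtension.degreeZero ε).Normal where
  conj_mem k hk g := by
    change disp (g.loop + k.loop + -g.loop) = 0
    rw [map_add, map_add, map_neg, show disp k.loop = 0 from hk]
    simp

/-- The underlying loops commute, so only the phase can change, by the ratio c(k, g) / c(g, k) of
cocycle values. As Δ' vanishes on k, both values of ε are 1 by normalisation and only the
exponentials of `pathForm` survive. -/
lemma conjBy_eq (g : CentralExtension ε) (k : CentralExtension.degreeZero ε) {ξ η : ℝ → 𝔥}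
    (h : S.IsLift g.loop ξ) (m : S.IsLift k.1.loop η) :
    (IndSpace.conjBy g k).1 = ⟨k.1.loop,
      k.1.phase * Circle.exp (2 * Real.pi * (pathForm η ξ - pathForm ξ η))⟩ := by
  change g⁻¹ * k.1 * g = _
  -- Comparing kg with g(g⁻¹kg) avoids the cocycle term in the formula for inverses.
  rw [mul_assoc, inv_mul_eq_iff_eq_mul]
  refine CentralExtension.ext (add_comm _ _) ?_
  change k.1.phase * g.phase * loopCocycle ε k.1.loop g.loop
    = g.phase * (k.1.phase * _) * loopCocycle ε g.loop k.1.loop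
  rw [loopCocycle_eq ε _ _ m h, loopCocycle_eq ε _ _ h m, show disp k.1.loop = 0 from k.2,
    ε.zero_left, ε.zero_right, one_mul, one_mul, mul_sub, Circle.exp_sub,
    mul_assoc g.phase, mul_assoc k.1.phase (_ / _), div_mul_cancel, mul_assoc, mul_left_comm]

lemma weylRep_apply (χ : AddChar S.interQuot Circle) (l : AddChar S.H Circle)
    (k : CentralExtension.degreeZero ε) : weylRep ε χ l k =
      weyl (oscillation k) (χ (monodromyN k) * l (averageH k) * k.1.phase) := rfl

/-- Oscillation, monodromy and average depend on the loop alone, which conjugation preserves; hence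
only the scalar in the Weyl operator is modified. -/
lemma weylRep_conjBy (χ : AddChar S.interQuot Circle) (l : AddChar S.H Circle)
    (g : CentralExtension ε) (k : CentralExtension.degreeZero ε) {ξ η : ℝ → 𝔥}
    (h : S.IsLift g.loop ξ) (m : S.IsLift k.1.loop η) :
    weylRep ε χ l (IndSpace.conjBy g k) = weyl (oscillation k)
      (χ (monodromyN k) * l (averageH k)
        * (k.1.phase * Circle.exp (2 * Real.pi * (pathForm η ξ - pathForm ξ η)))) := by
  have e : IndSpace.conjBy g k = ⟨⟨k.1.loop, k.1.phase * Circle.exp (2 * Real.pi *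
      (pathForm η ξ - pathForm ξ η))⟩, k.2⟩ := Subtype.ext (conjBy_eq g k h m)
  rw [e]
  rfl

/-- The chosen lift may differ from the constant x by an element of Γ: this cancels in the
oscillation and is invisible in H. -/
lemma oscillation_const {k : CentralExtension.degreeZero ε} {x : 𝔥}
    (m : S.IsLift k.1.loop fun _ => x) :
    oscillation k = 0 ∧ averageH k = QuotientAddGroup.mk x := by
  obtain ⟨v, hv, e⟩ := m.unique (isLift_lift k.1.loop)
  have ea : average (lift k.1.loop) = x + v := by simp [average, e]
  constructor
  · ext t
    change lift k.1.loop t - average (lift k.1.loop) = 0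
    rw [e, ea, sub_self]
  · rw [averageH, ea, eq_comm, QuotientAddGroup.eq]
    simpa using hv

/-- With a constant second argument, S and the endpoint correction in `pathForm` each contribute
half of ⟨Δ'g, x⟩; with the constant in the first argument both vanish. The conjugation phase is
therefore the character of -Δ'g at x. -/
lemma weylRep_const (χ : AddChar S.interQuot Circle) (l : AddChar S.H Circle)
    (g : CentralExtension ε) {k : CentralExtension.degreeZero ε} {x : 𝔥}
    (m : S.IsLift k.1.loop fun _ => x) (v : FockSpace 𝔥) :
    weylRep ε χ l (IndSpace.conjBy g k) v = ((χ (monodromyN k) * l (QuotientAddGroup.mk x)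
        * (k.1.phase * Circle.exp (2 * Real.pi * ⟪-(disp g.loop : 𝔥), x⟫)) : Circle) : ℂ) • v := by
  have h := isLift_lift g.loop
  obtain ⟨e1, e2⟩ := oscillation_const m
  have e3 : pathForm (fun _ => x) (lift g.loop) - pathForm (lift g.loop) (fun _ => x)
      = ⟪-(disp g.loop : 𝔥), x⟫ := by
    rw [disp_eq _ h, pathForm, pathForm, loopForm_const_left, loopForm_const_right h.smooth,
      sub_self, inner_zero_left, inner_neg_left]
    ring
  rw [weylRep_conjBy χ l g k h m, e1, e2, e3, weyl_zero]

/-! ### The two implications -/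

/-- W_{χ,l'} is exactly the conjugate of W_{χ,l} by an element with lift t • lam, so the two induce
unitarily isomorphic representations. -/
lemma unitarilyIsomorphic_indWeylRep (χ : AddChar S.interQuot Circle) {l l' : AddChar S.H Circle}
    {lam : 𝔥} (hlam : lam ∈ S.diff) (h : ∀ x : 𝔥, l' (QuotientAddGroup.mk x)
      = l (QuotientAddGroup.mk x) * (Circle.exp (2 * Real.pi * ⟪lam, x⟫))⁻¹) :
    UnitarilyIsomorphic (indWeylRep ε χ l) (indWeylRep ε χ l') := by
  obtain ⟨γ, hγ⟩ := exists_linear_loop hlam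
  refine unitarilyIsomorphic_inducedRep (⟨γ, 1⟩ : CentralExtension ε) fun k => ?_
  have m := isLift_lift k.1.loop
  have d : lift k.1.loop 1 = lift k.1.loop 0 := by
    have d0 : disp k.1.loop = 0 := k.2
    rw [← sub_eq_zero, ← disp_eq _ m, d0]
    rfl
  -- As the lift η of k is closed, the boundary term from swapping the arguments of S is ½⟨lam,
  -- η(0)⟩. It cancels the endpoint correction in `pathForm`, leaving -2 S(t • lam, η), which is
  -- minus the pairing of lam with the average.
  have e : pathForm (lift k.1.loop) (fun t => t • lam) - pathForm (fun t => t • lam) (lift k.1.loop)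
      = -⟪lam, average (lift k.1.loop)⟫ := by
    have e1 := loopForm_add_loopForm_swap hγ.smooth m.smooth
    have e2 := loopForm_smul_const lam m.smooth.continuous
    simp only [one_smul, zero_smul, inner_zero_left, sub_zero, d] at e1
    simp only [pathForm, one_smul, zero_smul, inner_zero_right, sub_zero, mul_zero]
    linarith
  rw [weylRep_conjBy χ l _ k hγ m, weylRep_apply, averageH, h, e, mul_neg, Circle.exp_neg]
  congr 1
  simp only [mul_comm, mul_assoc]

/-- Loops with constant lifts act on the fibre over each coset by scalars, and `exists_scalar_eq`
compares those of the trivial fibre on one side with those of a single fibre on the other. -/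
lemma eq_of_boundedlyIsomorphic_indWeylRep {χ χ' : AddChar S.interQuot Circle}
    {l l' : AddChar S.H Circle}
    (hU : BoundedlyIsomorphic (indWeylRep ε χ l) (indWeylRep ε χ' l')) :
    χ' = χ ∧ ∃ lam ∈ S.diff, ∀ x : 𝔥, l' (QuotientAddGroup.mk x)
      = l (QuotientAddGroup.mk x) * (Circle.exp (2 * Real.pi * ⟪lam, x⟫))⁻¹ := by
  choose γ hγ hd hm using fun i : 𝔥 × S.interQuot => exists_const_loop (S := S) i.1 i.2
  -- Phase 1 suffices: a central phase would contribute the same factor to both sides.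
  let k : 𝔥 × S.interQuot → CentralExtension.degreeZero ε := fun i => ⟨⟨γ i, 1⟩, hd i⟩
  have hk : ∀ i, monodromyN (k i) = i.2 := fun i => Subtype.ext (hm i)
  have ha : ∀ i v, weylRep ε χ l (k i) v
      = ((χ i.2 * l (QuotientAddGroup.mk i.1) : Circle) : ℂ) • v := fun i v => by
    obtain ⟨e1, e2⟩ := oscillation_const (k := k i) (hγ i)
    rw [weylRep_apply, e1, e2, weyl_zero, hk]
    change ((_ * 1 : Circle) : ℂ) • v = _
    rw [mul_one]
  -- A single g works for all pairs (x, n), so the displacement found does not depend on x.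
  obtain ⟨g, hg⟩ := exists_scalar_eq hU ha fun g i v => weylRep_const χ' l' g (hγ i) v
  have key : ∀ (x : 𝔥) (n : S.interQuot), χ n * l (QuotientAddGroup.mk x)
      = χ' n * l' (QuotientAddGroup.mk x)
        * Circle.exp (2 * Real.pi * ⟪-(disp g.loop : 𝔥), x⟫) := fun x n => by
    have := Circle.ext (hg (x, n))
    rwa [hk, one_mul] at this
  -- The sign is that of the conjugation phase, which is the character of -Δ'g. The choice x = 0
  -- isolates χ, and n = 0 isolates l.
  refine ⟨?_, -(disp g.loop : 𝔥), neg_mem (disp g.loop).2, fun x => ?_⟩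
  · ext1 n
    simpa using (key 0 n).symm
  · have := key x 0
    rw [AddChar.map_zero_eq_one, AddChar.map_zero_eq_one, one_mul, one_mul] at this
    rw [this, mul_inv_cancel_right]

end Conjugation

end LatticeSpan

end TorusLoop

end

/-- The condition on the characters yields a unitary intertwiner, which is in particular bounded
with bounded inverse, and a bounded one already forces the condition. -/
theorem mainTheorem2 {𝔥 𝔱w 𝔱b : Type*}
    [NormedAddCommGroup 𝔥] [InnerProductSpace ℝ 𝔥] [FiniteDimensional ℝ 𝔥]
    [NormedAddCommGroup 𝔱w] [InnerProductSpace ℝ 𝔱w] [FiniteDimensional ℝ 𝔱w]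
    [NormedAddCommGroup 𝔱b] [InnerProductSpace ℝ 𝔱b] [FiniteDimensional ℝ 𝔱b]
    (S : TorusLoop.LatticeSpan 𝔥 𝔱w 𝔱b) (ε : S.TwistCocycle)
    (χ χ' : AddChar S.interQuot Circle) (l l' : AddChar S.H Circle)
    (hl : Continuous l) (hl' : Continuous l') :
    (TorusLoop.UnitarilyIsomorphic (TorusLoop.LatticeSpan.indWeylRep ε χ l)
        (TorusLoop.LatticeSpan.indWeylRep ε χ' l') ↔
      χ' = χ ∧ ∃ lam ∈ S.diff, ∀ x : 𝔥,
        l' (QuotientAddGroup.mk x)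
          = l (QuotientAddGroup.mk x) * (Circle.exp (2 * Real.pi * ⟪lam, x⟫))⁻¹) ∧
    (TorusLoop.BoundedlyIsomorphic (TorusLoop.LatticeSpan.indWeylRep ε χ l)
        (TorusLoop.LatticeSpan.indWeylRep ε χ' l') ↔
      χ' = χ ∧ ∃ lam ∈ S.diff, ∀ x : 𝔥,
        l' (QuotientAddGroup.mk x)
          = l (QuotientAddGroup.mk x) * (Circle.exp (2 * Real.pi * ⟪lam, x⟫))⁻¹) := by
  have h1 : (χ' = χ ∧ ∃ lam ∈ S.diff, ∀ x : 𝔥,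
        l' (QuotientAddGroup.mk x)
          = l (QuotientAddGroup.mk x) * (Circle.exp (2 * Real.pi * ⟪lam, x⟫))⁻¹) →
      TorusLoop.UnitarilyIsomorphic (TorusLoop.LatticeSpan.indWeylRep ε χ l)
        (TorusLoop.LatticeSpan.indWeylRep ε χ' l') := by
    rintro ⟨rfl, lam, hlam, h⟩
    exact TorusLoop.LatticeSpan.unitarilyIsomorphic_indWeylRep _ hlam h
  exact ⟨⟨fun h => TorusLoop.LatticeSpan.eq_of_boundedlyIsomorphic_indWeylRep
      h.boundedlyIsomorphic, h1⟩,
    ⟨TorusLoop.LatticeSpan.eq_of_boundedlyIsomorphic_indWeylRep,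
      fun h => (h1 h).boundedlyIsomorphic⟩⟩
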